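/- Let $P,J\in\mathbb N$, let $\mathcal X\subset\mathbb R^P$ be compact, and let $h_1,\dots,h_J$ and $g$ be real-valued functions of class $C^1$ on an open neighbourhood of $\mathcal X$, with $\nabla h_j(x)\neq 0$ whenever $x\in\mathcal X$ and $h_j(x)=0$. For real numbers $c_1,\dots,c_J$ put $$f(x)=\sum_{j=1}^J c_j\,\mathbf 1[h_j(x)\le 0]+g(x).$$ Let $\mu$ be a probability measure on $\mathcal X$ with a continuous Lebesgue density $\delta:\mathcal X\to[0,\infty)$. With $z$ uniformly distributed on the Euclidean ball of radius $r$ about $0$, let $$\beta_r(x)=\mathbb E[zz^\top]^{-1}\,\mathbb E[z\,f(x+z)],\qquad \mathbf B^r_{f,\mu}=\mathbb E_{x\sim\mu}\big[\beta_r(x)\beta_r(x)^\top\big],$$ $$A_P=\frac{\sqrt\pi\;\Gamma\big(\tfrac{P+3}{2}\big)^2\,\Gamma\big(P+\tfrac52\big)}{\Gamma\big(\tfrac{P+4}{2}\big)^2\,\Gamma(P+2)}.$$ Let $\mathcal H^{P-1}$ be the $(P-1)$-dimensional surface (Hausdorff) measure. Assume that the discontinuities do not overlap substantially, neither with each other nor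 with the boundary of $\mathcal X$: for all $j\ne k$, $$\mathcal H^{P-1}\{x\in\mathcal X: h_j(x)=h_k(x)=0,\ \delta(x)\neq0\}=0,\qquad \mathcal H^{P-1}\{x\in\partial\mathcal X: h_j(x)=0,\ \delta(x)\neq0\}=0$$ (the second condition for every $j$, also when $J=1$). Then $f$ is integrable on the ball of radius $r$ about every $x\in\mathcal X$, and the expectation defining $\mathbf B^r_{f,\mu}$ exists, for all sufficiently small $r>0$; the surface integrals below converge absolutely; and $$\lim_{r\to0^+}A_P\,r\,\mathbf B^r_{f,\mu}=\sum_{j=1}^J c_j^2\int_{\{x\in\mathcal X:\,h_j(x)=0\}}\frac{\nabla h_j(x)\nabla h_j(x)^\top}{\|\nabla h_j(x)\|^2}\,\delta(x)\,d\mathcal H^{P-1}(x).$$ -/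

import Mathlib

open MeasureTheory Filter Topology
open scoped Matrix Gradient

noncomputable section

/-- The function `∑ j, c j * 1[h j x ≤ 0] + g x`. -/
def jumpFunction {P J : ℕ} (c : Fin J → ℝ) (h : Fin J → EuclideanSpace ℝ (Fin P) → ℝ)
    (g : EuclideanSpace ℝ (Fin P) → ℝ) (x : EuclideanSpace ℝ (Fin P)) : ℝ :=
  ∑ j, c j * Set.indicator {y | h j y ≤ 0} (fun _ => (1 : ℝ)) x + g x

/-- The second moment matrix `E[z zᵀ]` of the uniform distribution on the Euclidean ball of
radius `r` about the origin. -/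
def ballSecondMoment (P : ℕ) (r : ℝ) : Matrix (Fin P) (Fin P) ℝ :=
  Matrix.of fun i k => ⨍ z in Metric.ball (0 : EuclideanSpace ℝ (Fin P)) r, z i * z k

/-- The local regression coefficient `β_r(x) = E[z zᵀ]⁻¹ E[z f(x + z)]`, with `z` uniform on the
Euclidean ball of radius `r` about the origin. -/
def localRegressionCoeff {P : ℕ} (f : EuclideanSpace ℝ (Fin P) → ℝ) (r : ℝ)
    (x : EuclideanSpace ℝ (Fin P)) : Fin P → ℝ :=
  (ballSecondMoment P r)⁻¹ *ᵥ
    fun i => ⨍ z in Metric.ball (0 : EuclideanSpace ℝ (Fin P)) r, z i * f (x + z)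

/-- The matrix `B^r_{f,μ} = E_{x ∼ μ}[β_r(x) β_r(x)ᵀ]`. -/
def regressionOuterProduct {P : ℕ} (f : EuclideanSpace ℝ (Fin P) → ℝ)
    (μ : Measure (EuclideanSpace ℝ (Fin P))) (r : ℝ) : Matrix (Fin P) (Fin P) ℝ :=
  Matrix.of fun i k =>
    ∫ x, Matrix.vecMulVec (localRegressionCoeff f r x) (localRegressionCoeff f r x) i k ∂μ

/-- The matrix `∇h(x) ∇h(x)ᵀ / ‖∇h(x)‖²`. -/
def normalOuterProduct {P : ℕ} (h : EuclideanSpace ℝ (Fin P) → ℝ)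
    (x : EuclideanSpace ℝ (Fin P)) : Matrix (Fin P) (Fin P) ℝ :=
  (1 / ‖∇ h x‖ ^ 2) • Matrix.vecMulVec (∇ h x).ofLp (∇ h x).ofLp

/-- The normalizing constant `A_P`, which depends on the dimension only; `A_1 = 5 / 3`. -/
def jumpConst (P : ℕ) : ℝ :=
  √Real.pi * Real.Gamma (((P : ℝ) + 3) / 2) ^ 2 * Real.Gamma ((P : ℝ) + 5 / 2) /
    (Real.Gamma (((P : ℝ) + 4) / 2) ^ 2 * Real.Gamma ((P : ℝ) + 2))

end

/-! Write `z = r w` with `w` uniform on the unit ball. Rotational symmetry gives `E[z zᵀ] = r² / (P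
+ 2) • 1`, so `β_r(x)` is `(P + 2) / r` times the moment `E[w f(x + r w)]`. Hence `r B^r` is `(P +
2)² r⁻¹` times the integral of `δ` against the outer square of that moment. The moment is linear in
`f`, so this splits into a double sum over the pieces of `f`: the unit jumps and `g`
(`tendsto_integral_momentProduct_jumpPiece`).

As `E[w] = 0`, the moment of `g` is `O(r)`, and the pair `(g, g)` contributes `r⁻¹ O(r²)`. The
moment of the jump of `h` vanishes unless `h` changes sign on the ball, that is, outside a layer
`|h| ≤ L r`. Inside the layer, at points with `h = r s` tending to `y`, the jump looks like a
half-space after blow-up, and its moment tends to `-n φ(s / ‖∇h(y)‖)`, where `n` is the unit normal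
and `φ` is `jumpProfile` (`tendsto_ballMoment_stepFunction`).

The layer has thickness of order `r / ‖∇h‖`, so `r⁻¹ ∫ F_r` tends to `∫_{h = 0} ‖∇h‖⁻¹ ∫ F₀(y, s) ds
dH` (`tendsto_integral_levelSet`). This follows from dominated convergence in charts that use `h` as
a coordinate, the area formula identifying the Hausdorff measure there; a partition of unity glues
the charts. Applied to a jump paired with itself, it gives the asserted surface integral times `∫
φ²`, a Beta integral which, with `(P + 2)²`, is the reciprocal of `A_P` (`jumpConst_mul_eq_one`).

In mixed pairs the second moment tends to zero at almost every point of the first surface where `δ ≠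
0`, which for two jumps is the overlap hypothesis. The boundary hypothesis makes `δ`, extended by
zero, continuous at almost every point of each surface. -/

/-! ### The area formula for injective immersions of class `C¹`. -/

section AreaFormula

open Module Set
open scoped ENNReal NNReal

/-- An inequality between measures that holds locally on an open set holds on that set. -/
theorem measure_le_of_locally_le {X : Type*} [TopologicalSpace X] [SecondCountableTopology X]
    [MeasurableSpace X] [OpensMeasurableSpace X] {μ ν : Measure X} {T : Set X}
    (h : ∀ x ∈ T, ∃ N ∈ 𝓝 x, ∀ A ⊆ N, A ⊆ T → MeasurableSet A → μ A ≤ ν A)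
    {A : Set X} (hAT : A ⊆ T) (hA : MeasurableSet A) : μ A ≤ ν A := by
  -- Second countability leaves countably many neighbourhoods; making them disjoint cuts `A` into
  -- pieces on which the local inequalities can be summed.
  choose! N hN hle using h
  obtain ⟨t, htT, htc, hcov⟩ := TopologicalSpace.countable_cover_nhdsWithin
    (f := fun x => interior (N x)) (s := T)
    (fun x hx => mem_nhdsWithin_of_mem_nhds (interior_mem_nhds.2 (hN x hx)))
  rcases t.eq_empty_or_nonempty with rfl | htne
  · have : A = ∅ := by
      apply eq_empty_of_subset_empty
      simpa using hAT.trans hcov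
    simp [this]
  obtain ⟨f, rfl⟩ := htc.exists_eq_range htne
  have hmeas : ∀ n, MeasurableSet (disjointed (fun n => interior (N (f n))) n) :=
    MeasurableSet.disjointed fun n => isOpen_interior.measurableSet
  have hun : A = ⋃ n, A ∩ disjointed (fun n => interior (N (f n))) n := by
    rw [← inter_iUnion, iUnion_disjointed, eq_comm, inter_eq_left]
    exact hAT.trans (by simpa using hcov)
  have hdis : Pairwise (Function.onFun Disjoint
      fun n => A ∩ disjointed (fun n => interior (N (f n))) n) := fun i j hij =>
    (disjoint_disjointed _ hij).mono inter_subset_right inter_subset_right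
  rw [hun, measure_iUnion hdis fun n => hA.inter (hmeas n),
    measure_iUnion hdis fun n => hA.inter (hmeas n)]
  refine ENNReal.tsum_le_tsum fun n => hle (f n) (htT (mem_range_self n)) _ ?_ ?_
    (hA.inter (hmeas n))
  · exact inter_subset_right.trans ((disjointed_subset _ _).trans interior_subset)
  · exact inter_subset_left.trans hAT

/-- If `φ` controls `ψ` up to a constant `K`, it controls the Hausdorff measures of images. -/
theorem euclideanHausdorffMeasure_image_le_of_dist_le {V E F : Type*} [PseudoMetricSpace V]
    [MetricSpace E] [MetricSpace F] [MeasurableSpace E] [BorelSpace E] [MeasurableSpace F]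
    [BorelSpace F] {φ : V → F} {ψ : V → E} {A : Set V} {K : ℝ≥0} (d : ℕ)
    (h : ∀ u ∈ A, ∀ v ∈ A, dist (ψ u) (ψ v) ≤ K * dist (φ u) (φ v)) :
    μHE[d] (ψ '' A) ≤ (K : ℝ≥0∞) ^ d * μHE[d] (φ '' A) := by
  rcases A.eq_empty_or_nonempty with rfl | hne
  · simp
  have : Nonempty V := ⟨hne.some⟩
  -- The hypothesis makes `ψ` constant on the fibres of `φ`, so `ψ` factors through `φ` by a
  -- `K`-Lipschitz map even when `φ` is not injective.
  have hL : LipschitzOnWith K (ψ ∘ Function.invFunOn φ A) (φ '' A) := by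
    apply LipschitzOnWith.of_dist_le_mul
    intro x hx y hy
    have := h _ (Function.invFunOn_mem hx) _ (Function.invFunOn_mem hy)
    rwa [Function.invFunOn_eq hx, Function.invFunOn_eq hy] at this
  have him : (ψ ∘ Function.invFunOn φ A) '' (φ '' A) = ψ '' A := by
    have key : ∀ u ∈ A, ψ (Function.invFunOn φ A (φ u)) = ψ u := by
      intro u hu
      have hm := mem_image_of_mem φ hu
      have := h _ (Function.invFunOn_mem hm) _ hu
      rw [Function.invFunOn_eq hm, dist_self, mul_zero] at this
      exact dist_le_zero.1 this
    rw [image_image]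
    exact image_congr key
  have := hL.hausdorffMeasure_image_le (d := (d : ℝ)) (by positivity)
  rw [him, ENNReal.rpow_natCast] at this
  simp_rw [Measure.euclideanHausdorffMeasure_def, Measure.smul_apply, ENNReal.smul_def, smul_eq_mul]
  calc _ ≤ _ := mul_le_mul_right this _
    _ = _ := mul_left_comm _ _ _

variable {V E : Type*} [NormedAddCommGroup V] [InnerProductSpace ℝ V] [FiniteDimensional ℝ V]
  [MeasurableSpace V] [BorelSpace V] [NormedAddCommGroup E] [InnerProductSpace ℝ E]
  [MeasurableSpace E] [BorelSpace E]

omit [MeasurableSpace V] [BorelSpace V] [MeasurableSpace E] [BorelSpace E] in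
/-- Near a point where the derivative is injective, a map is a small bi-Lipschitz perturbation of
its derivative. -/
theorem HasStrictFDerivAt.eventually_dist_comparable {ψ : V → E} {L : V →L[ℝ] E} {x : V}
    (hψ : HasStrictFDerivAt ψ L x) (hL : Function.Injective L) {C : ℝ} (hC : 1 < C) :
    ∃ N ∈ 𝓝 x, ∀ u ∈ N, ∀ v ∈ N, dist (ψ u) (ψ v) ≤ C * dist (L u) (L v) ∧
      dist (L u) (L v) ≤ C * dist (ψ u) (ψ v) := by
  obtain ⟨K, hK0, hK⟩ := (L : V →ₗ[ℝ] E).exists_antilipschitzWith (LinearMap.ker_eq_bot.2 hL)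
  have hanti : ∀ w, ‖w‖ ≤ K * ‖L w‖ := fun w => by
    simpa using hK.le_mul_dist w 0
  have hKpos : (0 : ℝ) < K := hK0
  have hη : 0 < 1 - C⁻¹ := sub_pos.2 (inv_lt_one_of_one_lt₀ hC)
  -- With this tolerance the antilipschitz bound `‖w‖ ≤ K ‖L w‖` turns the linearization error into
  -- at most `(1 - C⁻¹) ‖L (u - v)‖`.
  have hbound := hψ.isLittleO.bound (div_pos hη hKpos)
  rw [nhds_prod_eq] at hbound
  obtain ⟨N, hN, hNN⟩ := Filter.eventually_prod_self_iff'.1 hbound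
  refine ⟨N, hN, fun u hu v hv => ?_⟩
  have h1 := hNN u hu v hv
  have h2 : ‖ψ u - ψ v - L (u - v)‖ ≤ (1 - C⁻¹) * ‖L (u - v)‖ := by
    refine h1.trans ?_
    rw [div_mul_eq_mul_div, div_le_iff₀ hKpos]
    have := hanti (u - v)
    nlinarith
  have h3 := norm_sub_norm_le (ψ u - ψ v) (L (u - v))
  have h4 := norm_sub_norm_le (L (u - v)) (ψ u - ψ v)
  rw [norm_sub_rev (L (u - v))] at h4
  have hpos : 0 ≤ ‖L (u - v)‖ := norm_nonneg _
  have hC0 : 0 < C := by linarith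
  have hCi : C * C⁻¹ = 1 := mul_inv_cancel₀ hC0.ne'
  rw [dist_eq_norm, dist_eq_norm, ← map_sub]
  constructor
  -- The upper factor is `1 + (1 - C⁻¹)`, which is at most `C` because `C + C⁻¹ ≥ 2`.
  · have : 2 - C⁻¹ ≤ C := by nlinarith [sq_nonneg (C - 1), inv_pos.2 hC0]
    nlinarith
  · have h5 : C⁻¹ * ‖L (u - v)‖ ≤ ‖ψ u - ψ v‖ := by nlinarith
    calc ‖L (u - v)‖ = C * (C⁻¹ * ‖L (u - v)‖) := by rw [← mul_assoc, hCi, one_mul]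
      _ ≤ _ := mul_le_mul_of_nonneg_left h5 hC0.le

/-- The area formula for an injective immersion of class `C¹`. -/
theorem euclideanHausdorffMeasure_image_eq_lintegral_normDet {T : Set V} (hT : IsOpen T)
    {ψ : V → E} {ψ' : V → V →L[ℝ] E} {J : V → ℝ} (hψ : ∀ x ∈ T, HasStrictFDerivAt ψ (ψ' x) x)
    (hinj : InjOn ψ T) (himm : ∀ x ∈ T, Function.Injective (ψ' x))
    (hJ : ∀ x ∈ T, J x = (ψ' x : V →ₗ[ℝ] E).normDet) (hJc : ContinuousOn J T)
    {A : Set V} (hAT : A ⊆ T) (hA : MeasurableSet A) :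
    μHE[finrank ℝ V] (ψ '' A) = ∫⁻ x in A, ENNReal.ofReal (J x) := by
  have hψc : ContinuousOn ψ T := fun x hx =>
    (hψ x hx).hasFDerivAt.continuousAt.continuousWithinAt
  have hemb : MeasurableEmbedding (T.domRestrict ψ) :=
    hψc.measurableEmbedding hT.measurableSet hinj
  -- Both sides of the formula become measures on the parameter space, so that local comparison is
  -- enough.
  set ν : Measure V := (Measure.comap (T.domRestrict ψ) μHE[finrank ℝ V]).map (↑) with hν
  set σ : Measure V := volume.withDensity fun x => ENNReal.ofReal (J x) with hσ
  have hνA : ∀ B ⊆ T, MeasurableSet B → ν B = μHE[finrank ℝ V] (ψ '' B) := by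
    intro B hBT hB
    rw [hν, Measure.map_apply measurable_subtype_coe hB, hemb.comap_apply]
    congr 1
    rw [domRestrict_eq, image_comp, Subtype.image_preimage_coe, inter_eq_right.2 hBT]
  have hσA : ∀ B, MeasurableSet B → σ B = ∫⁻ x in B, ENNReal.ofReal (J x) := fun B hB =>
    withDensity_apply _ hB
  rw [← hνA A hAT hA, ← hσA A hA]
  set d := finrank ℝ V
  -- Replacing `ψ` by its derivative at `x` distorts distances by `C`, hence `d`-dimensional measure
  -- by `C ^ d`; freezing the continuous Jacobian at `x` costs one more factor `C`.
  have key : ∀ C : ℝ≥0, 1 < C → ∀ x ∈ T, ∃ N ∈ 𝓝 x, ∀ B ⊆ N, B ⊆ T → MeasurableSet B →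
      ν B ≤ (C : ℝ≥0∞) ^ (d + 1) * σ B ∧ σ B ≤ (C : ℝ≥0∞) ^ (d + 1) * ν B := by
    intro C hC x hx
    have hC' : (1 : ℝ) < C := hC
    obtain ⟨N, hN, hNd⟩ := (hψ x hx).eventually_dist_comparable (himm x hx) hC'
    have hJpos : 0 < J x := by
      rw [hJ x hx]
      refine (LinearMap.normDet_nonneg _).lt_of_ne' ?_
      exact ((LinearMap.normDet_ne_zero_tfae (ψ' x : V →ₗ[ℝ] E)).out 0 4).2 (himm x hx)
    have hJx : ContinuousAt J x := hJc.continuousAt (hT.mem_nhds hx)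
    have e1 : ∀ᶠ y in 𝓝 x, J y < C * J x :=
      hJx.eventually_lt_const (by nlinarith)
    have e2 : ∀ᶠ y in 𝓝 x, J x < C * J y :=
      (hJx.const_mul (C : ℝ)).eventually_const_lt (by nlinarith)
    refine ⟨N ∩ {y | J y < C * J x ∧ J x < C * J y}, inter_mem hN (e1.and e2),
      fun B hBN hBT hB => ?_⟩
    have hLB : μHE[d] (ψ' x '' B) = ENNReal.ofReal (J x) * volume B := by
      rw [hJ x hx]
      exact (ψ' x : V →ₗ[ℝ] E).euclideanHausdorffMeasure_image_eq_normDet_mul_volume B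
    have l1 : μHE[d] (ψ '' B) ≤ (C : ℝ≥0∞) ^ d * μHE[d] (ψ' x '' B) :=
      euclideanHausdorffMeasure_image_le_of_dist_le d fun u hu v hv =>
        (hNd u (hBN hu).1 v (hBN hv).1).1
    have l2 : μHE[d] (ψ' x '' B) ≤ (C : ℝ≥0∞) ^ d * μHE[d] (ψ '' B) :=
      euclideanHausdorffMeasure_image_le_of_dist_le d fun u hu v hv =>
        (hNd u (hBN hu).1 v (hBN hv).1).2
    have hCr : (C : ℝ≥0∞) = ENNReal.ofReal C := by simp
    have s1 : ENNReal.ofReal (J x) * volume B ≤ C * σ B := by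
      rw [hσA B hB, ← lintegral_const_mul' _ _ ENNReal.coe_ne_top, ← setLIntegral_const]
      refine setLIntegral_mono' hB fun y hy => ?_
      rw [hCr, ← ENNReal.ofReal_mul (by positivity)]
      exact ENNReal.ofReal_le_ofReal (hBN hy).2.2.le
    have s2 : σ B ≤ C * (ENNReal.ofReal (J x) * volume B) := by
      rw [hσA B hB, ← mul_assoc, ← setLIntegral_const]
      refine setLIntegral_mono' hB fun y hy => ?_
      rw [hCr, ← ENNReal.ofReal_mul (by positivity)]
      exact ENNReal.ofReal_le_ofReal (hBN hy).2.1.le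
    rw [hνA B hBT hB]
    constructor
    · calc _ ≤ _ := l1
        _ = (C : ℝ≥0∞) ^ d * (ENNReal.ofReal (J x) * volume B) := by rw [hLB]
        _ ≤ (C : ℝ≥0∞) ^ d * (C * σ B) := mul_le_mul_right s1 _
        _ = _ := by rw [pow_succ, mul_assoc]
    · calc _ ≤ _ := s2
        _ = (C : ℝ≥0∞) * μHE[d] (ψ' x '' B) := by rw [hLB]
        _ ≤ (C : ℝ≥0∞) * ((C : ℝ≥0∞) ^ d * μHE[d] (ψ '' B)) := mul_le_mul_right l2 _
        _ = _ := by rw [pow_succ', mul_assoc]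
  have glob : ∀ C : ℝ≥0, 1 < C →
      ν A ≤ (C : ℝ≥0∞) ^ (d + 1) * σ A ∧ σ A ≤ (C : ℝ≥0∞) ^ (d + 1) * ν A := by
    intro C hC
    constructor
    · refine measure_le_of_locally_le (μ := ν) (ν := ((C : ℝ≥0∞) ^ (d + 1)) • σ) (T := T)
        (fun x hx => ?_) hAT hA
      obtain ⟨N, hN, h⟩ := key C hC x hx
      exact ⟨N, hN, fun B h1 h2 h3 => (h B h1 h2 h3).1⟩
    · refine measure_le_of_locally_le (μ := σ) (ν := ((C : ℝ≥0∞) ^ (d + 1)) • ν) (T := T)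
        (fun x hx => ?_) hAT hA
      obtain ⟨N, hN, h⟩ := key C hC x hx
      exact ⟨N, hN, fun B h1 h2 h3 => (h B h1 h2 h3).2⟩
  -- Letting `C` decrease to `1` turns the two comparisons into equality.
  have lim : ∀ a : ℝ≥0∞, Tendsto (fun C : ℝ≥0 => (C : ℝ≥0∞) ^ (d + 1) * a) (𝓝[>] 1) (𝓝 a) := by
    intro a
    have h1 : Tendsto (fun C : ℝ≥0 => (C : ℝ≥0∞) ^ (d + 1)) (𝓝[>] 1) (𝓝 1) := by
      have h2 : Tendsto (fun C : ℝ≥0 => ((C ^ (d + 1) : ℝ≥0) : ℝ≥0∞)) (𝓝 1) (𝓝 ((1 : ℝ≥0) : ℝ≥0∞)) := by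
        rw [ENNReal.tendsto_coe]
        simpa using (continuous_pow (d + 1)).tendsto (1 : ℝ≥0)
      simpa using h2.mono_left nhdsWithin_le_nhds
    simpa using ENNReal.Tendsto.mul_const h1 (Or.inl one_ne_zero)
  apply le_antisymm
  · exact ge_of_tendsto (lim (σ A)) (eventually_nhdsWithin_of_forall fun C hC => (glob C hC).1)
  · exact ge_of_tendsto (lim (ν A)) (eventually_nhdsWithin_of_forall fun C hC => (glob C hC).2)

/-- The area formula as an identity of measures on the image. -/
theorem map_withDensity_normDet_eq_restrict {T : Set V} (hT : IsOpen T)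
    {ψ : V → E} {ψ' : V → V →L[ℝ] E} {J : V → ℝ} (hψ : ∀ x ∈ T, HasStrictFDerivAt ψ (ψ' x) x)
    (hinj : InjOn ψ T) (himm : ∀ x ∈ T, Function.Injective (ψ' x))
    (hJ : ∀ x ∈ T, J x = (ψ' x : V →ₗ[ℝ] E).normDet) (hJc : ContinuousOn J T) :
    Measure.map (T.domRestrict ψ)
        (Measure.comap (↑) (volume.withDensity fun x => ENNReal.ofReal (J x))) =
      μHE[finrank ℝ V].restrict (ψ '' T) := by
  have hψc : ContinuousOn ψ T := fun x hx =>
    (hψ x hx).hasFDerivAt.continuousAt.continuousWithinAt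
  have hemb : MeasurableEmbedding (T.domRestrict ψ) :=
    hψc.measurableEmbedding hT.measurableSet hinj
  ext B hB
  have hm : MeasurableSet ((↑) '' (T.domRestrict ψ ⁻¹' B) : Set V) :=
    hT.measurableSet.subtype_image (hemb.measurable hB)
  rw [Measure.map_apply hemb.measurable hB, Measure.restrict_apply hB,
    (MeasurableEmbedding.subtype_coe hT.measurableSet).comap_apply, withDensity_apply _ hm,
    ← euclideanHausdorffMeasure_image_eq_lintegral_normDet hT hψ hinj himm hJ hJc (by simp) hm,
    image_image]
  congr 1
  ext y
  simp only [mem_image, mem_preimage, mem_inter_iff, Subtype.exists, domRestrict_apply]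
  constructor
  · rintro ⟨a, ha, haB, rfl⟩
    exact ⟨haB, a, ha, rfl⟩
  · rintro ⟨hyB, a, ha, rfl⟩
    exact ⟨a, ha, hyB, rfl⟩

end AreaFormula

/-! ### Charts that straighten level sets, and surface measure in them. -/

section LevelChart

open Module Set
open scoped ENNReal NNReal RealInnerProductSpace

variable {E : Type*} [NormedAddCommGroup E] [InnerProductSpace ℝ E] [FiniteDimensional ℝ E]

/-- The linear map `w ↦ w + (⟪p, w⟫ - ⟪e, w⟫) e`. -/
noncomputable def shear (p e : E) : E →L[ℝ] E :=
  ContinuousLinearMap.id ℝ E + (innerSL ℝ p - innerSL ℝ e).smulRight e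

omit [FiniteDimensional ℝ E] in
theorem shear_apply (p e w : E) : shear p e w = w + (⟪p, w⟫ - ⟪e, w⟫) • e := by
  simp [shear]

/-- The map is the identity plus a rank-one map, so its determinant is `1 + (⟪p, e⟫ - ⟪e, e⟫)`. -/
theorem det_shear (p : E) {e : E} (he : ‖e‖ = 1) : (shear p e).det = ⟪p, e⟫ := by
  have h : (shear p e : E →ₗ[ℝ] E) =
      LinearMap.transvection ((innerSL ℝ p - innerSL ℝ e : E →L[ℝ] ℝ) : E →ₗ[ℝ] ℝ) e := by
    ext w
    simp [shear_apply, LinearMap.transvection.apply]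
  rw [ContinuousLinearMap.det, h, LinearMap.transvection.det]
  simp [he]

/-- The inverse of `shear p e` restricted to the orthogonal complement of `e`. -/
noncomputable def graphMap (p e : E) : (ℝ ∙ e)ᗮ →L[ℝ] E :=
  (ℝ ∙ e)ᗮ.subtypeL - (((⟪p, e⟫)⁻¹ • innerSL ℝ p) ∘L (ℝ ∙ e)ᗮ.subtypeL).smulRight e

omit [FiniteDimensional ℝ E] in
theorem graphMap_apply (p e : E) (v : (ℝ ∙ e)ᗮ) :
    graphMap p e v = (v : E) - ((⟪p, e⟫)⁻¹ * ⟪p, (v : E)⟫) • e := by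
  simp [graphMap]

omit [FiniteDimensional ℝ E] in
theorem inner_mem_orthogonal_span (e : E) (v : (ℝ ∙ e)ᗮ) : ⟪e, (v : E)⟫ = 0 :=
  Submodule.mem_orthogonal_singleton_iff_inner_right.1 v.2

-- The vector `graphMap p e v` is the lift of `v` along `e` to the hyperplane orthogonal to `p`;
-- `shear` replaces its `e`-component by its product with `p`, which is zero.
omit [FiniteDimensional ℝ E] in
theorem shear_graphMap {p e : E} (he : ‖e‖ = 1) (hpe : ⟪p, e⟫ ≠ 0) (v : (ℝ ∙ e)ᗮ) :
    shear p e (graphMap p e v) = v := by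
  have h1 := inner_mem_orthogonal_span e v
  rw [shear_apply, graphMap_apply, inner_sub_right, inner_sub_right, inner_smul_right,
    inner_smul_right, h1, real_inner_self_eq_norm_sq, he]
  have : ⟪p, (v : E)⟫ - (⟪p, e⟫)⁻¹ * ⟪p, (v : E)⟫ * ⟪p, e⟫ = 0 := by field_simp; ring
  rw [this, sub_add, sub_eq_self, ← sub_smul]
  simp

omit [FiniteDimensional ℝ E] in
theorem graphMap_injective {p e : E} (he : ‖e‖ = 1) (hpe : ⟪p, e⟫ ≠ 0) :
    Function.Injective (graphMap p e) := fun v w hvw => by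
  have := congrArg (shear p e) hvw
  rwa [shear_graphMap he hpe, shear_graphMap he hpe, SetLike.coe_eq_coe] at this

/-- The Gram operator is again the identity plus a rank-one map. With `b` the projection of `p` to
the complement of `e` and `c = ⟪p, e⟫`, its determinant is `1 + ‖b‖² / c²`, which is `‖p‖² / c²` by
Pythagoras. -/
theorem normDet_graphMap {p e : E} (he : ‖e‖ = 1) (hpe : 0 < ⟪p, e⟫) :
    (graphMap p e : (ℝ ∙ e)ᗮ →ₗ[ℝ] E).normDet = ‖p‖ / ⟪p, e⟫ := by
  set c := ⟪p, e⟫ with hc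
  set b : (ℝ ∙ e)ᗮ := (ℝ ∙ e)ᗮ.orthogonalProjectionOnto p with hb
  have hbp : ∀ v : (ℝ ∙ e)ᗮ, ⟪(b : E), (v : E)⟫ = ⟪p, (v : E)⟫ := fun v => by
    rw [hb, ← Submodule.coe_inner, Submodule.inner_orthogonalProjectionOnto_eq_of_mem_right]
  have hnorm : ‖p‖ ^ 2 = c ^ 2 + ‖(b : E)‖ ^ 2 := by
    rw [Submodule.norm_sq_eq_add_norm_sq_projection p (ℝ ∙ e)]
    congr 1
    rw [show ‖(ℝ ∙ e).orthogonalProjectionOnto p‖ =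
      ‖((ℝ ∙ e).orthogonalProjectionOnto p : E)‖ from rfl, Submodule.coe_orthogonalProjectionOnto_apply,
      Submodule.starProjection_unit_singleton ℝ he, norm_smul, he, mul_one, real_inner_comm]
    simp [hc]
  have hadj : (LinearMap.adjoint (graphMap p e : (ℝ ∙ e)ᗮ →ₗ[ℝ] E)) ∘ₗ
      (graphMap p e : (ℝ ∙ e)ᗮ →ₗ[ℝ] E) = LinearMap.transvection
        (((c⁻¹ • innerSL ℝ p) ∘L (ℝ ∙ e)ᗮ.subtypeL : (ℝ ∙ e)ᗮ →L[ℝ] ℝ) : (ℝ ∙ e)ᗮ →ₗ[ℝ] ℝ)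
        (c⁻¹ • b) := by
    refine LinearMap.ext fun v => ext_inner_right ℝ fun w => ?_
    rw [LinearMap.comp_apply, LinearMap.adjoint_inner_left, LinearMap.transvection.apply]
    have h1 : ⟪(v : E), e⟫ = 0 := by
      rw [real_inner_comm]
      exact inner_mem_orthogonal_span e v
    have h2 := inner_mem_orthogonal_span e w
    simp only [ContinuousLinearMap.coe_coe, graphMap_apply, Submodule.coe_inner, inner_sub_left,
      inner_sub_right, inner_smul_left, inner_smul_right, h1, h2, inner_add_left,
      hbp, real_inner_self_eq_norm_sq, he]
    simp [hc]
    ring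
  have hsq := LinearMap.normDet_sq (graphMap p e : (ℝ ∙ e)ᗮ →ₗ[ℝ] E)
  rw [hadj, LinearMap.transvection.det] at hsq
  have : (graphMap p e : (ℝ ∙ e)ᗮ →ₗ[ℝ] E).normDet ^ 2 = (‖p‖ / c) ^ 2 := by
    rw [div_pow, hnorm]
    simp only [RCLike.ofReal_real_eq_id, id] at hsq
    rw [hsq]
    simp only [ContinuousLinearMap.coe_coe, ContinuousLinearMap.comp_apply, map_smul,
      Submodule.subtypeL_apply, smul_apply, innerSL_apply_apply, smul_eq_mul]
    rw [← hbp, real_inner_self_eq_norm_sq]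
    field_simp
  exact (sq_eq_sq₀ (LinearMap.normDet_nonneg _) (by positivity)).1 this

/-- An open partial homeomorphism that straightens the level sets of `h` into the hyperplanes
orthogonal to the unit vector `e`. -/
structure IsLevelChart (h : E → ℝ) (U : Set E) (e : E) (Φ : OpenPartialHomeomorph E E) :
    Prop where
  norm_eq : ‖e‖ = 1
  source_subset : Φ.source ⊆ U
  apply_eq : ∀ x, Φ x = x + (h x - ⟪e, x⟫) • e
  inner_pos : ∀ x ∈ Φ.source, 0 < ⟪∇ h x, e⟫

theorem ContDiffOn.continuousOn_gradient {h : E → ℝ} {U : Set E} (hU : IsOpen U)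
    (hh : ContDiffOn ℝ 1 h U) : ContinuousOn (∇ h) U := by
  have := hh.continuousOn_fderiv_of_isOpen hU le_rfl
  exact (InnerProductSpace.toDual ℝ E).symm.continuous.comp_continuousOn this

theorem ContDiffOn.hasStrictFDerivAt_innerSL_gradient {h : E → ℝ} {U : Set E} (hU : IsOpen U)
    (hh : ContDiffOn ℝ 1 h U) {x : E} (hx : x ∈ U) :
    HasStrictFDerivAt h (innerSL ℝ (∇ h x)) x := by
  have h1 := (hh.contDiffAt (hU.mem_nhds hx)).hasStrictFDerivAt one_ne_zero
  have h2 : fderiv ℝ h x = innerSL ℝ (∇ h x) := by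
    rw [← toDual_gradient]
    rfl
  rwa [h2] at h1

theorem hasStrictFDerivAt_shear {h : E → ℝ} {x : E} (e : E)
    (hx : HasStrictFDerivAt h (innerSL ℝ (∇ h x)) x) :
    HasStrictFDerivAt (fun y => y + (h y - ⟪e, y⟫) • e) (shear (∇ h x) e) x := by
  have h1 : HasStrictFDerivAt (fun y : E => ⟪e, y⟫) (innerSL ℝ e) x :=
    (innerSL ℝ e).hasStrictFDerivAt
  exact (hasStrictFDerivAt_id x).add ((hx.sub h1).smul_const e)

/-- Level charts exist around every point at which the gradient does not vanish. -/
theorem exists_isLevelChart {h : E → ℝ} {U : Set E} (hU : IsOpen U) (hh : ContDiffOn ℝ 1 h U)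
    {x : E} (hx : x ∈ U) (hgrad : ∇ h x ≠ 0) :
    ∃ (e : E) (Φ : OpenPartialHomeomorph E E), x ∈ Φ.source ∧ IsLevelChart h U e Φ := by
  -- For the unit gradient direction the determinant of `shear` at `x` is `‖∇ h x‖`, so the inverse
  -- function theorem applies.
  set e : E := ‖∇ h x‖⁻¹ • ∇ h x with he
  have hn : 0 < ‖∇ h x‖ := norm_pos_iff.2 hgrad
  have hen : ‖e‖ = 1 := by
    rw [he, norm_smul, norm_inv, norm_norm, inv_mul_cancel₀ hn.ne']
  have hpos : 0 < ⟪∇ h x, e⟫ := by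
    rw [he, inner_smul_right, real_inner_self_eq_norm_sq]
    positivity
  have hd := hasStrictFDerivAt_shear e (hh.hasStrictFDerivAt_innerSL_gradient hU hx)
  have hdet : (shear (∇ h x) e).det ≠ 0 := by rw [det_shear _ hen]; exact hpos.ne'
  rw [← ContinuousLinearMap.coe_toContinuousLinearEquivOfDetNeZero _ hdet] at hd
  -- The source is shrunk to where the Jacobian stays positive, as `inner_pos` requires.
  have hopen : IsOpen (U ∩ {y | 0 < ⟪∇ h y, e⟫}) :=
    ((hh.continuousOn_gradient hU).inner continuousOn_const).isOpen_inter_preimage hU isOpen_Ioi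
  refine ⟨e, (hd.toOpenPartialHomeomorph _).restrOpen _ hopen, ?_, hen, ?_, fun y => ?_, ?_⟩
  · exact ⟨hd.mem_toOpenPartialHomeomorph_source, hx, hpos⟩
  · exact fun y hy => hy.2.1
  · rfl
  · exact fun y hy => hy.2.2

namespace IsLevelChart

variable {h : E → ℝ} {U : Set E} {e : E} {Φ : OpenPartialHomeomorph E E}

/-- The chart keeps the component orthogonal to `e` and makes the value of `h` the coordinate along
`e`. -/
theorem inner_apply (H : IsLevelChart h U e Φ) (x : E) : ⟪e, Φ x⟫ = h x := by
  rw [H.apply_eq, inner_add_right, inner_smul_right, real_inner_self_eq_norm_sq, H.norm_eq]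
  ring

theorem apply_symm (H : IsLevelChart h U e Φ) {u : E} (hu : u ∈ Φ.target) :
    h (Φ.symm u) = ⟪e, u⟫ := by
  rw [← H.inner_apply, Φ.right_inv hu]

theorem hasStrictFDerivAt (H : IsLevelChart h U e Φ) (hU : IsOpen U) (hh : ContDiffOn ℝ 1 h U)
    {x : E} (hx : x ∈ Φ.source) : HasStrictFDerivAt Φ (shear (∇ h x) e) x := by
  have := hasStrictFDerivAt_shear e
    (hh.hasStrictFDerivAt_innerSL_gradient hU (H.source_subset hx))
  rwa [← funext H.apply_eq] at this

/-- The points of the parameter hyperplane at which the chart is defined. -/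
def base (e : E) (Φ : OpenPartialHomeomorph E E) : Set (ℝ ∙ e)ᗮ := (↑) ⁻¹' Φ.target

omit [FiniteDimensional ℝ E] in
theorem isOpen_base (e : E) (Φ : OpenPartialHomeomorph E E) : IsOpen (base e Φ) :=
  Φ.open_target.preimage continuous_subtype_val

/-- The inverse of `shear` is the derivative of the inverse chart; on the complement of `e` it
agrees with `graphMap`, by `shear_graphMap`. -/
theorem hasStrictFDerivAt_symm (H : IsLevelChart h U e Φ) (hU : IsOpen U)
    (hh : ContDiffOn ℝ 1 h U) {v : (ℝ ∙ e)ᗮ} (hv : v ∈ base e Φ) :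
    HasStrictFDerivAt (fun v : (ℝ ∙ e)ᗮ => Φ.symm v) (graphMap (∇ h (Φ.symm v)) e) v := by
  have hs : Φ.symm v ∈ Φ.source := Φ.map_target hv
  have hpos := H.inner_pos _ hs
  have hdet : (shear (∇ h (Φ.symm v)) e).det ≠ 0 := by
    rw [det_shear _ H.norm_eq]; exact hpos.ne'
  have hd := H.hasStrictFDerivAt hU hh hs
  rw [← ContinuousLinearMap.coe_toContinuousLinearEquivOfDetNeZero _ hdet] at hd
  have h1 := (Φ.hasStrictFDerivAt_symm hv hd).comp v (ℝ ∙ e)ᗮ.subtypeL.hasStrictFDerivAt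
  convert! h1 using 1
  ext w
  rw [ContinuousLinearMap.comp_apply, ContinuousLinearEquiv.coe_coe,
    ContinuousLinearEquiv.eq_symm_apply,
    ContinuousLinearMap.toContinuousLinearEquivOfDetNeZero_apply,
    shear_graphMap H.norm_eq hpos.ne']
  rfl

theorem image_base (H : IsLevelChart h U e Φ) :
    (fun v : (ℝ ∙ e)ᗮ => Φ.symm v) '' base e Φ = {x ∈ Φ.source | h x = 0} := by
  ext x
  constructor
  · rintro ⟨v, hv, rfl⟩
    exact ⟨Φ.map_target hv, by rw [H.apply_symm hv, inner_mem_orthogonal_span]⟩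
  · rintro ⟨hx, hx0⟩
    refine ⟨⟨Φ x, ?_⟩, ?_, Φ.left_inv hx⟩
    · rw [Submodule.mem_orthogonal_singleton_iff_inner_right, H.inner_apply, hx0]
    · exact Φ.map_source hx

theorem continuousOn_gradient_symm (H : IsLevelChart h U e Φ) (hU : IsOpen U)
    (hh : ContDiffOn ℝ 1 h U) : ContinuousOn (fun u => ∇ h (Φ.symm u)) Φ.target :=
  (hh.continuousOn_gradient hU).comp Φ.continuousOn_symm fun _ hu =>
    H.source_subset (Φ.map_target hu)

variable [MeasurableSpace E] [BorelSpace E]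

/-- The surface measure of a level set in the coordinates of a level chart. -/
theorem map_eq_restrict (H : IsLevelChart h U e Φ) (hU : IsOpen U) (hh : ContDiffOn ℝ 1 h U) :
    Measure.map ((base e Φ).domRestrict fun v : (ℝ ∙ e)ᗮ => Φ.symm v)
      (Measure.comap (↑) (volume.withDensity fun v : (ℝ ∙ e)ᗮ =>
        ENNReal.ofReal (‖∇ h (Φ.symm v)‖ / ⟪∇ h (Φ.symm v), e⟫))) =
      μHE[finrank ℝ E - 1].restrict {x ∈ Φ.source | h x = 0} := by
  -- The unit vector `e` forces positive dimension, so the truncated subtraction is a genuine one.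
  have hfr : finrank ℝ (ℝ ∙ e)ᗮ = finrank ℝ E - 1 := by
    have h1 := (ℝ ∙ e).finrank_add_finrank_orthogonal
    rw [finrank_span_singleton (norm_ne_zero_iff.1 (by rw [H.norm_eq]; exact one_ne_zero))] at h1
    omega
  have hc : ContinuousOn (fun v : (ℝ ∙ e)ᗮ => ∇ h (Φ.symm v)) (base e Φ) :=
    (H.continuousOn_gradient_symm hU hh).comp continuous_subtype_val.continuousOn fun _ hv => hv
  rw [← H.image_base, ← hfr]
  refine map_withDensity_normDet_eq_restrict (isOpen_base e Φ)
    (fun v hv => H.hasStrictFDerivAt_symm hU hh hv) ?_ (fun v hv => ?_) (fun v hv => ?_) ?_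
  · intro v hv w hw hvw
    exact Subtype.ext (Φ.symm.injOn hv hw hvw)
  · exact graphMap_injective H.norm_eq (H.inner_pos _ (Φ.map_target hv)).ne'
  · exact (normDet_graphMap H.norm_eq (H.inner_pos _ (Φ.map_target hv))).symm
  · exact hc.norm.div (hc.inner continuousOn_const) fun v hv =>
      (H.inner_pos _ (Φ.map_target hv)).ne'

end IsLevelChart

end LevelChart

/-! ### Concentration on a level set inside one chart. -/

section LocalLimit

open Module Set
open scoped ENNReal NNReal RealInnerProductSpace

variable {E : Type*} [NormedAddCommGroup E] [InnerProductSpace ℝ E] [FiniteDimensional ℝ E]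
  [MeasurableSpace E] [BorelSpace E]

/-- Coordinates `v + t e` with `v` orthogonal to the unit vector `e`. -/
noncomputable def orthogonalCoordinates (e : E) (he : ‖e‖ = 1) : (ℝ ∙ e)ᗮ × ℝ ≃ᵐ E :=
  MeasurableEquiv.prodComm.trans <|
    (MeasurableEquiv.prodCongr
      (LinearIsometryEquiv.toSpanUnitSingleton (𝕜 := ℝ) e he).toHomeomorph.toMeasurableEquiv
      (MeasurableEquiv.refl _)).trans ((ℝ ∙ e).measurableEquivProd (0 : E)).symm

theorem orthogonalCoordinates_apply (e : E) (he : ‖e‖ = 1) (q : (ℝ ∙ e)ᗮ × ℝ) :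
    orthogonalCoordinates e he q = (q.1 : E) + q.2 • e := by
  have : orthogonalCoordinates e he q = ((ℝ ∙ e).measurableEquivProd (0 : E)).symm
    (LinearIsometryEquiv.toSpanUnitSingleton (𝕜 := ℝ) e he q.2, q.1) := rfl
  rw [this, Submodule.measurableEquivProd_symm_apply]
  simp [add_comm]

theorem measurePreserving_orthogonalCoordinates (e : E) (he : ‖e‖ = 1) :
    MeasurePreserving (orthogonalCoordinates e he) volume volume := by
  have h1 := ((ℝ ∙ e).measurePreserving_measurableEquivProd (0 : E)).symm
  rw [InnerProductSpace.euclideanHausdorffMeasure_eq_volume] at h1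
  have h2 := (LinearIsometryEquiv.toSpanUnitSingleton (𝕜 := ℝ) e he).measurePreserving.prod
    (MeasurePreserving.id (volume : Measure (ℝ ∙ e)ᗮ))
  have h3 : MeasurePreserving (Prod.swap : (ℝ ∙ e)ᗮ × ℝ → ℝ × (ℝ ∙ e)ᗮ)
    (volume.prod volume) (volume.prod volume) := Measure.measurePreserving_swap
  exact h1.comp (h2.comp h3)

omit [FiniteDimensional ℝ E] [MeasurableSpace E] [BorelSpace E] in
theorem inner_orthogonal_add_smul {e : E} (he : ‖e‖ = 1) (v : (ℝ ∙ e)ᗮ) (t : ℝ) :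
    ⟪e, (v : E) + t • e⟫ = t := by
  rw [inner_add_right, inner_smul_right, inner_mem_orthogonal_span, real_inner_self_eq_norm_sq,
    he]
  ring

omit [FiniteDimensional ℝ E] [MeasurableSpace E] [BorelSpace E] in
theorem norm_orthogonal_add_smul_sq {e : E} (he : ‖e‖ = 1) (v : (ℝ ∙ e)ᗮ) (t : ℝ) :
    ‖(v : E) + t • e‖ ^ 2 = ‖v‖ ^ 2 + t ^ 2 := by
  rw [← real_inner_self_eq_norm_sq, inner_add_left, inner_smul_left,
    inner_orthogonal_add_smul he, inner_add_right, inner_smul_right, real_inner_comm e (v : E),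
    inner_mem_orthogonal_span, real_inner_self_eq_norm_sq]
  simp
  ring

omit [FiniteDimensional ℝ E] [MeasurableSpace E] [BorelSpace E] in
theorem norm_le_norm_orthogonal_add_smul {e : E} (he : ‖e‖ = 1) (v : (ℝ ∙ e)ᗮ) (t : ℝ) :
    ‖v‖ ≤ ‖(v : E) + t • e‖ := by
  have := norm_orthogonal_add_smul_sq he v t
  exact abs_le_of_sq_le_sq' (by nlinarith [sq_nonneg t]) (norm_nonneg _) |>.2

namespace IsLevelChart

variable {h : E → ℝ} {U : Set E} {e : E} {Φ : OpenPartialHomeomorph E E}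

theorem measurableEmbedding_domRestrict (e : E) (Φ : OpenPartialHomeomorph E E) :
    MeasurableEmbedding ((base e Φ).domRestrict fun v : (ℝ ∙ e)ᗮ => Φ.symm v) := by
  refine ContinuousOn.measurableEmbedding (isOpen_base e Φ).measurableSet ?_ ?_
  · exact Φ.continuousOn_symm.comp continuous_subtype_val.continuousOn fun _ hv => hv
  · exact fun v hv w hw hvw => Subtype.ext (Φ.symm.injOn hv hw hvw)

omit [MeasurableSpace E] [BorelSpace E] in
theorem continuousOn_density (H : IsLevelChart h U e Φ) (hU : IsOpen U)
    (hh : ContDiffOn ℝ 1 h U) :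
    ContinuousOn (fun v : (ℝ ∙ e)ᗮ => ‖∇ h (Φ.symm v)‖ / ⟪∇ h (Φ.symm v), e⟫) (base e Φ) := by
  have hc : ContinuousOn (fun v : (ℝ ∙ e)ᗮ => ∇ h (Φ.symm v)) (base e Φ) :=
    (H.continuousOn_gradient_symm hU hh).comp continuous_subtype_val.continuousOn fun _ hv => hv
  exact hc.norm.div (hc.inner continuousOn_const) fun v hv =>
      (H.inner_pos _ (Φ.map_target hv)).ne'

omit [MeasurableSpace E] [BorelSpace E] in
theorem density_pos (H : IsLevelChart h U e Φ) {v : (ℝ ∙ e)ᗮ} (hv : v ∈ base e Φ) :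
    0 < ‖∇ h (Φ.symm v)‖ / ⟪∇ h (Φ.symm v), e⟫ := by
  have h1 := H.inner_pos _ (Φ.map_target hv)
  refine div_pos (norm_pos_iff.2 fun h0 => ?_) h1
  rw [h0, inner_zero_left] at h1
  exact lt_irrefl _ h1

/-- The surface density is positive on the base, so surface-null exceptional sets pull back to
Lebesgue-null sets of parameters. -/
theorem ae_base (H : IsLevelChart h U e Φ) (hU : IsOpen U) (hh : ContDiffOn ℝ 1 h U)
    {p : E → Prop} (hp : ∀ᵐ y ∂μHE[finrank ℝ E - 1].restrict {x ∈ Φ.source | h x = 0}, p y) :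
    ∀ᵐ v : (ℝ ∙ e)ᗮ ∂volume, v ∈ base e Φ → p (Φ.symm v) := by
  have hm := (isOpen_base e Φ).measurableSet
  have hJ := (H.continuousOn_density hU hh).aemeasurable (μ := volume) hm
  rw [← H.map_eq_restrict hU hh, (measurableEmbedding_domRestrict e Φ).ae_map_iff] at hp
  have h2 : ∀ᵐ v : (ℝ ∙ e)ᗮ ∂(Measure.map ((↑) : base e Φ → (ℝ ∙ e)ᗮ) (Measure.comap (↑)
      (volume.withDensity fun v : (ℝ ∙ e)ᗮ =>
        ENNReal.ofReal (‖∇ h (Φ.symm v)‖ / ⟪∇ h (Φ.symm v), e⟫)))), p (Φ.symm v) :=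
    (MeasurableEmbedding.subtype_coe hm).ae_map_iff (p := fun v : (ℝ ∙ e)ᗮ => p (Φ.symm v)) |>.2 hp
  rw [map_comap_subtype_coe hm, restrict_withDensity hm, ae_withDensity_iff' hJ.ennreal_ofReal,
    ae_restrict_iff' hm] at h2
  filter_upwards [h2] with v hv hvb
  exact hv hvb (by simpa using H.density_pos hvb)

theorem setIntegral_levelSet (H : IsLevelChart h U e Φ) (hU : IsOpen U)
    (hh : ContDiffOn ℝ 1 h U) (f : E → ℝ) :
    ∫ y in {x ∈ Φ.source | h x = 0}, f y ∂μHE[finrank ℝ E - 1] =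
      ∫ v in base e Φ, ‖∇ h (Φ.symm v)‖ / ⟪∇ h (Φ.symm v), e⟫ * f (Φ.symm v) := by
  have hm := (isOpen_base e Φ).measurableSet
  have hJ := (H.continuousOn_density hU hh).aemeasurable (μ := volume) hm
  rw [← H.map_eq_restrict hU hh, (measurableEmbedding_domRestrict e Φ).integral_map]
  simp only [Set.domRestrict_apply]
  rw [← (MeasurableEmbedding.subtype_coe hm).integral_map (fun v => f (Φ.symm v)),
    map_comap_subtype_coe hm]
  simp only [ENNReal.ofReal]
  rw [setIntegral_withDensity_eq_setIntegral_smul₀ hJ.real_toNNReal _ hm]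
  refine setIntegral_congr_fun hm fun v hv => ?_
  simp only [NNReal.smul_def, smul_eq_mul]
  rw [Real.coe_toNNReal _ (H.density_pos hv).le]

theorem setLIntegral_levelSet (H : IsLevelChart h U e Φ) (hU : IsOpen U)
    (hh : ContDiffOn ℝ 1 h U) {A : Set E} (hA : MeasurableSet A) :
    μHE[finrank ℝ E - 1] (A ∩ {x ∈ Φ.source | h x = 0}) =
      ∫⁻ v in (fun v : (ℝ ∙ e)ᗮ => Φ.symm v) ⁻¹' A ∩ base e Φ,
        ENNReal.ofReal (‖∇ h (Φ.symm v)‖ / ⟪∇ h (Φ.symm v), e⟫) := by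
  have hm := (isOpen_base e Φ).measurableSet
  have hemb := measurableEmbedding_domRestrict e Φ
  rw [← Measure.restrict_apply hA, ← H.map_eq_restrict hU hh,
    Measure.map_apply hemb.measurable hA, (MeasurableEmbedding.subtype_coe hm).comap_apply,
    withDensity_apply _ (hm.subtype_image (hemb.measurable hA))]
  congr 2
  ext v
  constructor
  · rintro ⟨a, ha, rfl⟩
    exact ⟨ha, a.2⟩
  · rintro ⟨hvA, hv⟩
    exact ⟨⟨v, hv⟩, hvA, rfl⟩

/-- Change of variables: the Jacobian of the chart is `⟪∇ h x, e⟫`, positive on the source. -/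
theorem setIntegral_source (H : IsLevelChart h U e Φ) (hU : IsOpen U)
    (hh : ContDiffOn ℝ 1 h U) (f : E → ℝ) :
    ∫ x in Φ.source, f x = ∫ u in Φ.target, (⟪∇ h (Φ.symm u), e⟫)⁻¹ * f (Φ.symm u) := by
  rw [integral_target_eq_integral_abs_det_fderiv_smul volume
    (fun x hx => (H.hasStrictFDerivAt hU hh hx).hasFDerivAt)]
  refine setIntegral_congr_fun Φ.open_source.measurableSet fun x hx => ?_
  have hpos := H.inner_pos x hx
  simp only [smul_eq_mul]
  rw [Φ.left_inv hx, det_shear _ H.norm_eq, abs_of_pos hpos, mul_inv_cancel_left₀ hpos.ne']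

/-- The integral of a function supported in the domain of a level chart, in chart coordinates. -/
theorem integral_eq_integral_integral (H : IsLevelChart h U e Φ) (hU : IsOpen U)
    (hh : ContDiffOn ℝ 1 h U) {f : E → ℝ} (hf : ∀ x ∉ Φ.source, f x = 0) {G : E → ℝ}
    (hG : G = Φ.target.indicator fun u => (⟪∇ h (Φ.symm u), e⟫)⁻¹ * f (Φ.symm u))
    (hGi : Integrable G) {r : ℝ} (hr : 0 < r) :
    r⁻¹ * ∫ x, f x = ∫ v : (ℝ ∙ e)ᗮ, ∫ s : ℝ, G (v + (r * s) • e) := by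
  have h1 : ∫ x, f x = ∫ u, G u := by
    rw [← setIntegral_eq_integral_of_forall_compl_eq_zero hf, H.setIntegral_source hU hh, hG,
      integral_indicator Φ.open_target.measurableSet]
  have hmp := measurePreserving_orthogonalCoordinates e H.norm_eq
  have hemb := (orthogonalCoordinates e H.norm_eq).measurableEmbedding
  have hGi' : Integrable (fun q => G (orthogonalCoordinates e H.norm_eq q))
      ((volume : Measure (ℝ ∙ e)ᗮ).prod (volume : Measure ℝ)) :=
    (hmp.integrable_comp_emb hemb).2 hGi
  rw [h1, ← hmp.integral_comp hemb, Measure.volume_eq_prod, integral_prod _ hGi',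
    ← integral_const_mul]
  refine integral_congr_ae (Eventually.of_forall fun v => ?_)
  simp only [orthogonalCoordinates_apply]
  -- The substitution `t = r s` in the normal coordinate absorbs the factor `r⁻¹`.
  rw [Measure.integral_comp_mul_left (fun t => G (v + t • e)), abs_of_pos (inv_pos.2 hr),
    smul_eq_mul]

/-- Concentration of integrals on a level set, in the domain of one level chart. -/
theorem tendsto_integral (H : IsLevelChart h U e Φ) (hU : IsOpen U)
    (hh : ContDiffOn ℝ 1 h U) {K : Set E} (hK : IsCompact K) (hKs : K ⊆ Φ.source)
    {F : ℝ → E → ℝ} {F₀ : E → ℝ → ℝ} {M L : ℝ}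
    (hmeas : ∀ᶠ r in 𝓝[>] 0, Measurable (F r))
    (hM : ∀ᶠ r in 𝓝[>] 0, ∀ x, |F r x| ≤ M)
    (hsupp : ∀ᶠ r in 𝓝[>] 0, ∀ x, F r x ≠ 0 → x ∈ K ∧ |h x| ≤ L * r)
    (hlim : ∀ᵐ y ∂μHE[finrank ℝ E - 1].restrict {x ∈ Φ.source | h x = 0}, ∀ᵐ s : ℝ,
      ∀ x : ℝ → E, Tendsto x (𝓝[>] 0) (𝓝 y) → (∀ᶠ r in 𝓝[>] 0, h (x r) = r * s) →
        Tendsto (fun r => F r (x r)) (𝓝[>] 0) (𝓝 (F₀ y s))) :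
    Tendsto (fun r => r⁻¹ * ∫ x, F r x) (𝓝[>] 0)
      (𝓝 (∫ y in {x ∈ Φ.source | h x = 0}, ‖∇ h y‖⁻¹ * (∫ s, F₀ y s) ∂μHE[finrank ℝ E - 1])) := by
  have he := H.norm_eq
  set D : E → ℝ := fun u => (⟪∇ h (Φ.symm u), e⟫)⁻¹ with hD
  set G : ℝ → E → ℝ := fun r => Φ.target.indicator fun u => D u * F r (Φ.symm u) with hG
  have hDc : ContinuousOn D Φ.target :=
    ((H.continuousOn_gradient_symm hU hh).inner continuousOn_const).inv₀ fun u hu =>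
      (H.inner_pos _ (Φ.map_target hu)).ne'
  have hKc : IsCompact (Φ '' K) := hK.image_of_continuousOn (Φ.continuousOn.mono hKs)
  have hKt : Φ '' K ⊆ Φ.target := by
    rintro _ ⟨x, hx, rfl⟩
    exact Φ.map_source (hKs hx)
  obtain ⟨C, hC0, hC⟩ : ∃ C : ℝ, 0 ≤ C ∧ ∀ u ∈ Φ '' K, ‖D u‖ ≤ C := by
    obtain ⟨C, hC⟩ := hKc.exists_bound_of_continuousOn (hDc.mono hKt)
    exact ⟨max C 0, le_max_right _ _, fun u hu => (hC u hu).trans (le_max_left _ _)⟩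
  obtain ⟨R, hR⟩ := hKc.isBounded.exists_norm_le
  have hM0 : 0 ≤ M := by
    obtain ⟨r, hr⟩ := hM.exists
    exact (abs_nonneg _).trans (hr 0)
  have hGsupp : ∀ᶠ r in 𝓝[>] 0, ∀ u, G r u ≠ 0 → u ∈ Φ '' K ∧ |⟪e, u⟫| ≤ L * r := by
    filter_upwards [hsupp] with r hr u hu
    have hut : u ∈ Φ.target := mem_of_indicator_ne_zero hu
    have hF : F r (Φ.symm u) ≠ 0 := by
      intro h0
      apply hu
      simp [hG, h0]
    obtain ⟨h1, h2⟩ := hr _ hF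
    rw [H.apply_symm hut] at h2
    exact ⟨⟨_, h1, Φ.right_inv hut⟩, h2⟩
  have hGbound : ∀ᶠ r in 𝓝[>] 0, ∀ u, ‖G r u‖ ≤ C * M := by
    filter_upwards [hM, hGsupp] with r hr hs u
    by_cases hu : G r u = 0
    · rw [hu, norm_zero]
      positivity
    · obtain ⟨h1, -⟩ := hs u hu
      simp only [hG, indicator_of_mem (hKt h1), norm_mul]
      exact mul_le_mul (hC u h1) (hr _) (abs_nonneg _) hC0
  have hGmeas : ∀ᶠ r in 𝓝[>] 0, Measurable (G r) := by
    classical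
    filter_upwards [hmeas] with r hr
    have m1 : Measurable (Φ.target.piecewise Φ.symm 0) :=
      Φ.continuousOn_symm.measurable_piecewise continuousOn_const Φ.open_target.measurableSet
    have m2 : Measurable (Φ.target.piecewise D 0) :=
      hDc.measurable_piecewise continuousOn_const Φ.open_target.measurableSet
    convert! m2.mul (hr.comp m1) using 1
    ext u
    by_cases hu : u ∈ Φ.target <;> simp [hG, hu]
  have hGint : ∀ᶠ r in 𝓝[>] 0, Integrable (G r) := by
    filter_upwards [hGsupp, hGbound, hGmeas] with r h1 h2 h3
    rw [← integrableOn_iff_integrable_of_support_subset (s := Φ '' K) fun u hu => (h1 u hu).1]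
    exact Measure.integrableOn_of_bounded hKc.measure_lt_top.ne h3.aestronglyMeasurable
      (Eventually.of_forall h2)
  have hpos : ∀ᶠ r : ℝ in 𝓝[>] 0, 0 < r := self_mem_nhdsWithin
  have hline : ∀ (v : (ℝ ∙ e)ᗮ) (s : ℝ),
      Tendsto (fun r : ℝ => (v : E) + (r * s) • e) (𝓝[>] 0) (𝓝 (v : E)) := fun v s => by
    have : Tendsto (fun r : ℝ => (v : E) + (r * s) • e) (𝓝 0) (𝓝 ((v : E) + ((0 : ℝ) * s) • e)) :=
      Continuous.tendsto (by fun_prop) _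
    simpa using this.mono_left nhdsWithin_le_nhds
  -- In the coordinate `s` the layer `|h| ≤ L r` becomes `|s| ≤ L`, so one bounded function with
  -- bounded support dominates for all small `r`.
  have hGs : ∀ᶠ r in 𝓝[>] 0, ∀ (v : (ℝ ∙ e)ᗮ) (s : ℝ), ‖G r (v + (r * s) • e)‖ ≤
      (Metric.closedBall 0 R).indicator (fun _ => (Icc (-L) L).indicator (fun _ => C * M) s) v := by
    filter_upwards [hGsupp, hGbound, hpos] with r h1 h2 h3 v s
    by_cases hu : G r (v + (r * s) • e) = 0
    · rw [hu, norm_zero]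
      refine indicator_nonneg (fun _ _ => indicator_nonneg (fun _ _ => by positivity) _) _
    · obtain ⟨h4, h5⟩ := h1 _ hu
      rw [inner_orthogonal_add_smul he, abs_mul, abs_of_pos h3, mul_comm,
        mul_le_mul_iff_left₀ h3] at h5
      rw [indicator_of_mem, indicator_of_mem]
      · exact h2 _
      · exact abs_le.1 h5
      · rw [mem_closedBall_zero_iff]
        exact (norm_le_norm_orthogonal_add_smul he v _).trans (hR _ h4)
  have hinner : ∀ᵐ v : (ℝ ∙ e)ᗮ ∂volume,
      Tendsto (fun r : ℝ => ∫ s : ℝ, G r (v + (r * s) • e)) (𝓝[>] 0)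
        (𝓝 ((base e Φ).indicator (fun v => D v * ∫ s, F₀ (Φ.symm v) s) v)) := by
    filter_upwards [H.ae_base hU hh hlim] with v hv
    have hbd : Integrable (fun s : ℝ => (Icc (-L) L).indicator (fun _ => C * M) s) :=
      (integrable_indicator_iff measurableSet_Icc).2
        (integrableOn_const isCompact_Icc.measure_lt_top.ne)
    have hb0 : ∀ s : ℝ, (Icc (-L) L).indicator (fun _ => C * M) s ≥ 0 := fun s =>
      indicator_nonneg (fun _ _ => by positivity) _
    have hlimit : (base e Φ).indicator (fun v => D v * ∫ s, F₀ (Φ.symm v) s) v =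
        ∫ s, (base e Φ).indicator (fun v => D v * F₀ (Φ.symm v) s) v := by
      by_cases hvb : v ∈ base e Φ <;> simp [hvb, integral_const_mul]
    rw [hlimit]
    refine tendsto_integral_filter_of_dominated_convergence _ ?_ ?_ hbd ?_
    · filter_upwards [hGmeas] with r hr
      exact (hr.comp (by fun_prop)).aestronglyMeasurable
    · filter_upwards [hGs] with r hr
      refine Eventually.of_forall fun s => (hr v s).trans ?_
      exact indicator_apply_le' (fun _ => le_rfl) fun _ => hb0 s
    · by_cases hvb : v ∈ base e Φ
      · filter_upwards [hv hvb] with s hs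
        have hev : ∀ᶠ r in 𝓝[>] 0, (v : E) + (r * s) • e ∈ Φ.target :=
          (hline v s).eventually (Φ.open_target.mem_nhds hvb)
        -- The curves `r ↦ Φ.symm (v + r s e)` satisfy `h = r s`: these are the test curves allowed
        -- in `hlim`.
        have hx := hs (fun r => Φ.symm (v + (r * s) • e))
          ((Φ.symm.continuousAt hvb).tendsto.comp (hline v s)) (by
            filter_upwards [hev] with r hr
            rw [H.apply_symm hr, inner_orthogonal_add_smul he])
        have hD' : Tendsto (fun r => D (v + (r * s) • e)) (𝓝[>] 0) (𝓝 (D v)) :=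
          (hDc.continuousAt (Φ.open_target.mem_nhds hvb)).tendsto.comp (hline v s)
        rw [indicator_of_mem hvb]
        refine (hD'.mul hx).congr' ?_
        filter_upwards [hev] with r hr
        simp [hG, hr]
      · refine Eventually.of_forall fun s => ?_
        rw [indicator_of_notMem hvb]
        refine tendsto_const_nhds.congr' ?_
        -- The compact image of `K` misses `v`, so the integrand vanishes along the line for small
        -- `r`.
        have hnK : (v : E) ∉ Φ '' K := fun h' => hvb (hKt h')
        filter_upwards [hGsupp, (hline v s).eventually
          (hKc.isClosed.isOpen_compl.mem_nhds hnK)] with r h1 h2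
        by_contra h3
        exact h2 (h1 _ (Ne.symm h3)).1
  have houter : Tendsto (fun r : ℝ => ∫ v : (ℝ ∙ e)ᗮ, ∫ s : ℝ, G r (v + (r * s) • e)) (𝓝[>] 0)
      (𝓝 (∫ v : (ℝ ∙ e)ᗮ, (base e Φ).indicator (fun v => D v * ∫ s, F₀ (Φ.symm v) s) v)) := by
    refine tendsto_integral_filter_of_dominated_convergence
      ((Metric.closedBall 0 R).indicator fun _ =>
        ∫ s : ℝ, (Icc (-L) L).indicator (fun _ => C * M) s) ?_ ?_ ?_ hinner
    · filter_upwards [hGmeas] with r hr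
      have : Measurable fun q : (ℝ ∙ e)ᗮ × ℝ => G r (q.1 + (r * q.2) • e) :=
        hr.comp (by fun_prop)
      exact this.stronglyMeasurable.integral_prod_right.aestronglyMeasurable
    · filter_upwards [hGs] with r hr
      refine Eventually.of_forall fun v => ?_
      by_cases hv : v ∈ Metric.closedBall (0 : (ℝ ∙ e)ᗮ) R
      · rw [indicator_of_mem hv]
        refine norm_integral_le_of_norm_le
          ((integrable_indicator_iff measurableSet_Icc).2
        (integrableOn_const isCompact_Icc.measure_lt_top.ne)) ?_
        refine Eventually.of_forall fun s => ?_
        simpa [hv] using hr v s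
      · rw [indicator_of_notMem hv]
        have : ∀ s, G r (v + (r * s) • e) = 0 := fun s => by
          simpa [hv] using hr v s
        simp [this]
    · exact (integrable_indicator_iff measurableSet_closedBall).2
        (integrableOn_const (isCompact_closedBall _ _).measure_lt_top.ne)
  -- The surface density `‖∇h‖ / ⟪∇h, e⟫` times `‖∇h‖⁻¹` leaves the inverse Jacobian `D`.
  have hval : ∫ y in {x ∈ Φ.source | h x = 0}, ‖∇ h y‖⁻¹ * (∫ s, F₀ y s) ∂μHE[finrank ℝ E - 1] =
      ∫ v : (ℝ ∙ e)ᗮ, (base e Φ).indicator (fun v => D v * ∫ s, F₀ (Φ.symm v) s) v := by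
    rw [H.setIntegral_levelSet hU hh, integral_indicator (isOpen_base e Φ).measurableSet]
    refine setIntegral_congr_fun (isOpen_base e Φ).measurableSet fun v hv => ?_
    have hp := H.density_pos hv
    have hp2 := H.inner_pos _ (Φ.map_target hv)
    have hp3 : ‖∇ h (Φ.symm v)‖ ≠ 0 := fun h0 => by simp [h0] at hp
    simp only [hD]
    field_simp
  rw [hval]
  refine houter.congr' ?_
  filter_upwards [hGint, hpos, hsupp] with r h1 h2 h3
  refine (H.integral_eq_integral_integral hU hh (fun x hx => ?_) rfl h1 h2).symm
  by_contra h4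
  exact hx (hKs (h3 x h4).1)

end IsLevelChart

end LocalLimit

/-! ### Gluing the local limits by a partition of unity. -/

section GlobalLimit

open Module Set
open scoped ENNReal NNReal RealInnerProductSpace

variable {E : Type*} [NormedAddCommGroup E] [InnerProductSpace ℝ E] [FiniteDimensional ℝ E]
  [MeasurableSpace E] [BorelSpace E]

variable {h : E → ℝ} {X U : Set E}

omit [InnerProductSpace ℝ E] [FiniteDimensional ℝ E] [MeasurableSpace E] [BorelSpace E] in
theorem IsCompact.levelSet (hX : IsCompact X) (hc : ContinuousOn h X) :
    IsCompact {x ∈ X | h x = 0} :=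
  hX.of_isClosed_subset (hc.preimage_isClosed_of_isClosed hX.isClosed isClosed_singleton)
    inter_subset_left

/-- A regular compact level set has finite surface measure. -/
theorem euclideanHausdorffMeasure_levelSet_lt_top (hX : IsCompact X) (hU : IsOpen U)
    (hXU : X ⊆ U) (hh : ContDiffOn ℝ 1 h U) (hgrad : ∀ x ∈ X, h x = 0 → ∇ h x ≠ 0) :
    μHE[finrank ℝ E - 1] {x ∈ X | h x = 0} < ∞ := by
  refine (hX.levelSet (hh.continuousOn.mono hXU)).measure_lt_top_of_nhdsWithin fun x hx => ?_
  obtain ⟨e, Φ, hxΦ, H⟩ := exists_isLevelChart hU hh (hXU hx.1) (hgrad x hx.1 hx.2)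
  obtain ⟨K, hK, hxK, hKs⟩ := exists_compact_subset Φ.open_source hxΦ
  have hKc : IsCompact (Φ '' K) := hK.image_of_continuousOn (Φ.continuousOn.mono hKs)
  have hKt : Φ '' K ⊆ Φ.target := by
    rintro _ ⟨x, hx, rfl⟩
    exact Φ.map_source (hKs hx)
  set B : Set (ℝ ∙ e)ᗮ := (↑) ⁻¹' (Φ '' K) with hB
  have hBc : IsCompact B :=
    (Submodule.closed_of_finiteDimensional (ℝ ∙ e)ᗮ).isClosedEmbedding_subtypeVal.isCompact_preimage
      hKc
  have hBb : B ⊆ IsLevelChart.base e Φ := fun v hv => hKt hv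
  obtain ⟨C, hC⟩ := hBc.exists_bound_of_continuousOn ((H.continuousOn_density hU hh).mono hBb)
  -- Over a compact piece the parameters form a compact set, on which the continuous surface density
  -- is bounded.
  have hfin : μHE[finrank ℝ E - 1] (K ∩ {x ∈ Φ.source | h x = 0}) < ∞ := by
    rw [H.setLIntegral_levelSet hU hh hK.measurableSet]
    have hsub : (fun v : (ℝ ∙ e)ᗮ => Φ.symm v) ⁻¹' K ∩ IsLevelChart.base e Φ ⊆ B :=
      fun v hv => ⟨Φ.symm v, hv.1, Φ.right_inv hv.2⟩
    refine (lintegral_mono_set hsub).trans_lt ?_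
    refine (setLIntegral_mono' (g := fun _ => ENNReal.ofReal C) hBc.measurableSet fun v hv =>
      ENNReal.ofReal_le_ofReal ((le_abs_self _).trans (hC v hv))).trans_lt ?_
    rw [setLIntegral_const]
    exact ENNReal.mul_lt_top ENNReal.ofReal_lt_top hBc.measure_lt_top
  refine ⟨K ∩ {x ∈ X | h x = 0}, inter_mem (mem_nhdsWithin_of_mem_nhds
    (mem_of_superset (isOpen_interior.mem_nhds hxK) interior_subset)) self_mem_nhdsWithin, ?_⟩
  exact (measure_mono (t := K ∩ {x ∈ Φ.source | h x = 0})
    fun y hy => ⟨hy.1, hKs hy.1, hy.2.2⟩).trans_lt hfin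

/-- Concentration of integrals on a regular compact level set. -/
theorem tendsto_integral_levelSet (hX : IsCompact X) (hU : IsOpen U)
    (hXU : X ⊆ U) (hh : ContDiffOn ℝ 1 h U) (hgrad : ∀ x ∈ X, h x = 0 → ∇ h x ≠ 0)
    {F : ℝ → E → ℝ} {F₀ : E → ℝ → ℝ} {M L : ℝ}
    (hmeas : ∀ᶠ r in 𝓝[>] 0, Measurable (F r))
    (hM : ∀ᶠ r in 𝓝[>] 0, ∀ x, |F r x| ≤ M)
    (hsupp : ∀ᶠ r in 𝓝[>] 0, ∀ x, F r x ≠ 0 → x ∈ X ∧ |h x| ≤ L * r)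
    (hlim : ∀ᵐ y ∂μHE[finrank ℝ E - 1].restrict {x ∈ X | h x = 0}, ∀ᵐ s : ℝ,
      ∀ x : ℝ → E, Tendsto x (𝓝[>] 0) (𝓝 y) → (∀ᶠ r in 𝓝[>] 0, h (x r) = r * s) →
        Tendsto (fun r => F r (x r)) (𝓝[>] 0) (𝓝 (F₀ y s)))
    (hint : IntegrableOn (fun y => ‖∇ h y‖⁻¹ * ∫ s, F₀ y s) {x ∈ X | h x = 0}
      μHE[finrank ℝ E - 1]) :
    Tendsto (fun r => r⁻¹ * ∫ x, F r x) (𝓝[>] 0)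
      (𝓝 (∫ y in {x ∈ X | h x = 0}, ‖∇ h y‖⁻¹ * (∫ s, F₀ y s) ∂μHE[finrank ℝ E - 1])) := by
  have hcX : ContinuousOn h X := hh.continuousOn.mono hXU
  set Z := {x ∈ X | h x = 0} with hZ
  have hZc : IsCompact Z := hX.levelSet hcX
  have hZm : MeasurableSet Z := hZc.measurableSet
  have hchart : ∀ x : Z, ∃ (e : E) (Φ : OpenPartialHomeomorph E E), (x : E) ∈ Φ.source ∧
      IsLevelChart h U e Φ := fun x =>
    exists_isLevelChart hU hh (hXU x.2.1) (hgrad x x.2.1 x.2.2)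
  choose e' Φ' hxΦ H' using hchart
  obtain ⟨t, ht⟩ := hZc.elim_finite_subcover (fun x => (Φ' x).source) (fun x => (Φ' x).open_source)
    fun x hx => mem_iUnion.2 ⟨⟨x, hx⟩, hxΦ _⟩
  set n := t.card
  set ι : Fin n → Z := fun i => (t.equivFin.symm i : Z)
  set S : Fin n → Set E := fun i => (Φ' (ι i)).source with hS
  have hSo : ∀ i, IsOpen (S i) := fun i => (Φ' (ι i)).open_source
  have hcov : Z ⊆ ⋃ i, S i := by
    intro x hx
    obtain ⟨z, hz, hxz⟩ := mem_iUnion₂.1 (ht hx)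
    exact mem_iUnion.2 ⟨t.equivFin ⟨z, hz⟩, by simpa [hS, ι] using hxz⟩
  have hdiffc : IsCompact (X \ ⋃ i, S i) := hX.diff (isOpen_iUnion hSo)
  -- Outside the charts `|h|` has a positive lower bound `η` on `X`, so the layer `|h| ≤ η / 2` lies
  -- inside them.
  obtain ⟨η, hη, hηle⟩ := hdiffc.exists_forall_le' (f := fun x => |h x|) (a := 0)
    ((hcX.mono sdiff_subset).abs) fun x hx => abs_pos.2 fun h0 => hx.2 (hcov ⟨hx.1, h0⟩)
  set K := X ∩ {x | |h x| ≤ η / 2} with hK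
  have hKc : IsCompact K := hX.of_isClosed_subset
    (hcX.abs.preimage_isClosed_of_isClosed hX.isClosed isClosed_Iic) inter_subset_left
  have hKcov : K ⊆ ⋃ i, S i := by
    intro x hx
    by_contra hxS
    have h1 := hηle x ⟨hx.1, hxS⟩
    have h2 : |h x| ≤ η / 2 := hx.2
    linarith
  obtain ⟨ρ, hρs, hρ1, hρI, hρc⟩ := exists_continuous_sum_one_of_isOpen_isCompact hSo hKc hKcov
  set φ : E → ℝ := fun y => ‖∇ h y‖⁻¹ * ∫ s, F₀ y s with hφ
  have hρabs : ∀ i x, |ρ i x| ≤ 1 := fun i x => abs_le.2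
    ⟨by linarith [(hρI i x).1], (hρI i x).2⟩
  have hlocal : ∀ i, Tendsto (fun r => r⁻¹ * ∫ x, ρ i x * F r x) (𝓝[>] 0)
      (𝓝 (∫ y in Z, ρ i y * φ y ∂μHE[finrank ℝ E - 1])) := by
    intro i
    have hcS : ContinuousOn h (S i) := hh.continuousOn.mono (H' (ι i)).source_subset
    have hSm : MeasurableSet {x ∈ S i | h x = 0} := by
      have h1 : IsOpen (S i ∩ h ⁻¹' {0}ᶜ) :=
        hcS.isOpen_inter_preimage (hSo i) isOpen_compl_singleton
      have h2 : {x ∈ S i | h x = 0} = S i \ (S i ∩ h ⁻¹' {0}ᶜ) := by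
        ext x
        simp
      rw [h2]
      exact (hSo i).measurableSet.diff h1.measurableSet
    have hT := (H' (ι i)).tendsto_integral hU hh (K := tsupport (ρ i)) (hρc i) (hρs i)
      -- A chart may contain zeros of `h` outside `X`; the indicator in the limit function discards
      -- them.
      (F := fun r x => ρ i x * F r x)
      (F₀ := fun y s => ρ i y * X.indicator (fun y => F₀ y s) y) (M := M) (L := L) ?_ ?_ ?_ ?_
    · convert! hT using 2
      have hfe : ∀ y, ‖∇ h y‖⁻¹ * (∫ s, ρ i y * X.indicator (fun y => F₀ y s) y) =
          X.indicator (fun y => ρ i y * φ y) y := fun y => by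
        by_cases hy : y ∈ X
        · simp only [indicator_of_mem hy, integral_const_mul, hφ]
          ring
        · simp [hy]
      simp_rw [hfe]
      have h1 : ∫ y in {x ∈ S i | h x = 0}, X.indicator (fun y => ρ i y * φ y) y
          ∂μHE[finrank ℝ E - 1] = ∫ y in Z ∩ S i, X.indicator (fun y => ρ i y * φ y) y
          ∂μHE[finrank ℝ E - 1] := by
        refine setIntegral_eq_of_subset_of_forall_sdiff_eq_zero hSm
          (fun y hy => ⟨hy.2, hy.1.2⟩) fun y hy => ?_
        exact indicator_of_notMem (fun hyX => hy.2 ⟨⟨hyX, hy.1.2⟩, hy.1.1⟩) _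
      have h2 : ∫ y in Z, X.indicator (fun y => ρ i y * φ y) y
          ∂μHE[finrank ℝ E - 1] = ∫ y in Z ∩ S i, X.indicator (fun y => ρ i y * φ y) y
          ∂μHE[finrank ℝ E - 1] := by
        refine setIntegral_eq_of_subset_of_forall_sdiff_eq_zero hZm
          inter_subset_left fun y hy => ?_
        have : ρ i y = 0 := by
          by_contra h0
          exact hy.2 ⟨hy.1, hρs i (subset_tsupport _ h0)⟩
        rw [indicator_of_mem hy.1.1, this, zero_mul]
      rw [h1, ← h2]
      exact setIntegral_congr_fun hZm fun y hy =>
        (indicator_of_mem hy.1 fun y => ρ i y * φ y).symm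
    · filter_upwards [hmeas] with r hr
      exact (ρ i).continuous.measurable.mul hr
    · filter_upwards [hM] with r hr x
      rw [abs_mul]
      calc |ρ i x| * |F r x| ≤ 1 * |F r x| :=
            mul_le_mul_of_nonneg_right (hρabs i x) (abs_nonneg _)
        _ ≤ M := by rw [one_mul]; exact hr x
    · filter_upwards [hsupp] with r hr x hx
      exact ⟨subset_tsupport _ (left_ne_zero_of_mul hx), (hr x (right_ne_zero_of_mul hx)).2⟩
    · rw [ae_restrict_iff' hSm]
      rw [ae_restrict_iff' hZm] at hlim
      filter_upwards [hlim] with y hy hyS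
      by_cases hyX : y ∈ X
      · filter_upwards [hy ⟨hyX, hyS.2⟩] with s hs x hx hxs
        rw [indicator_of_mem hyX]
        exact (((ρ i).continuous.tendsto y).comp hx).mul (hs x hx hxs)
      · refine Eventually.of_forall fun s x hx _ => ?_
        rw [indicator_of_notMem hyX, mul_zero]
        refine tendsto_const_nhds.congr' ?_
        filter_upwards [hsupp, hx.eventually (hX.isClosed.isOpen_compl.mem_nhds hyX)] with r h1 h2
        have h0 : F r (x r) = 0 := by
          by_contra h3
          exact h2 (h1 _ h3).1
        rw [h0, mul_zero]
  have hsum := tendsto_finsetSum Finset.univ fun i _ => hlocal i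
  have hFint : ∀ᶠ r in 𝓝[>] 0, Integrable (F r) := by
    filter_upwards [hsupp, hM, hmeas] with r h1 h2 h3
    rw [← integrableOn_iff_integrable_of_support_subset (s := X) fun u hu => (h1 u hu).1]
    exact Measure.integrableOn_of_bounded hX.measure_lt_top.ne h3.aestronglyMeasurable
      (Eventually.of_forall h2)
  have hsmall : ∀ᶠ r in 𝓝[>] (0 : ℝ), L * r ≤ η / 2 := by
    have : Tendsto (fun r : ℝ => L * r) (𝓝[>] 0) (𝓝 0) := by
      have h1 : Tendsto (fun r : ℝ => L * r) (𝓝 0) (𝓝 (L * 0)) :=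
        (continuous_const.mul continuous_id).tendsto 0
      rw [mul_zero] at h1
      exact h1.mono_left nhdsWithin_le_nhds
    exact this.eventually_le_const (by positivity)
  have hbd : ∀ i, ∀ᵐ x ∂(μHE[finrank ℝ E - 1].restrict Z), ‖ρ i x‖ ≤ 1 := fun i =>
    Eventually.of_forall (hρabs i)
  -- The partition sums to one only on `K`, which suffices: for small `r` the support of `F r` lies
  -- in `K`.
  have hone : ∀ x ∈ K, ∑ i, ρ i x = 1 := fun x hx => by
    simpa using hρ1 hx
  have hval : ∑ i, ∫ y in Z, ρ i y * φ y ∂μHE[finrank ℝ E - 1] =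
      ∫ y in Z, φ y ∂μHE[finrank ℝ E - 1] := by
    rw [← integral_finsetSum _ fun i _ =>
      hint.bdd_mul (ρ i).continuous.aestronglyMeasurable (hbd i)]
    refine setIntegral_congr_fun hZm fun y hy => ?_
    rw [← Finset.sum_mul, hone y ⟨hy.1, by simp [hy.2, (half_pos hη).le]⟩, one_mul]
  rw [hval] at hsum
  refine hsum.congr' ?_
  filter_upwards [hFint, hsmall, hsupp] with r h1 h2 h3
  rw [← Finset.mul_sum, ← integral_finsetSum _ fun i _ =>
    h1.bdd_mul (ρ i).continuous.aestronglyMeasurable (Eventually.of_forall (hρabs i))]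
  congr 1
  refine integral_congr_ae (Eventually.of_forall fun x => ?_)
  beta_reduce
  rw [← Finset.sum_mul]
  by_cases h0 : F r x = 0
  · rw [h0, mul_zero]
  · rw [hone x ⟨(h3 x h0).1, (h3 x h0).2.trans h2⟩, one_mul]

end GlobalLimit

/-! ### Slices of the unit ball and their Beta integrals. -/

section BallIntegrals

open Module Set Metric
open scoped ENNReal NNReal RealInnerProductSpace

/-- The integral of `(1 - t²)^a` over `[-1, 1]`. -/
noncomputable def sliceIntegral (a : ℝ) : ℝ := ∫ t in (-1 : ℝ)..1, (1 - t ^ 2) ^ a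

theorem integral_rpow_mul_one_sub_rpow {a b : ℝ} (ha : 0 ≤ a) (hb : 0 ≤ b) :
    ∫ x in (0 : ℝ)..1, x ^ a * (1 - x) ^ b =
      Real.Gamma (a + 1) * Real.Gamma (b + 1) / Real.Gamma (a + b + 2) := by
  have h1 := ProbabilityTheory.beta_eq_betaIntegralReal (a + 1) (b + 1) (by linarith) (by linarith)
  rw [ProbabilityTheory.beta, show a + 1 + (b + 1) = a + b + 2 by ring] at h1
  rw [h1, Complex.betaIntegral]
  have h2 : ∫ x in (0 : ℝ)..1, (x : ℂ) ^ (((a + 1 : ℝ) : ℂ) - 1) *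
      (1 - (x : ℂ)) ^ (((b + 1 : ℝ) : ℂ) - 1) =
      ∫ x in (0 : ℝ)..1, (((x ^ a * (1 - x) ^ b : ℝ)) : ℂ) := by
    refine intervalIntegral.integral_congr fun x hx => ?_
    rw [uIcc_of_le zero_le_one] at hx
    push_cast
    rw [Complex.ofReal_cpow hx.1, Complex.ofReal_cpow (by linarith [hx.2])]
    push_cast
    congr 2 <;> ring
  rw [h2, intervalIntegral.integral_ofReal, Complex.ofReal_re]

/-- The substitution `t = 2x - 1` gives `2 · 4^a` times a symmetric Beta integral, and Legendre's
duplication formula removes `Γ(2a + 2)`. -/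
theorem sliceIntegral_eq {a : ℝ} (ha : 0 ≤ a) :
    sliceIntegral a = √Real.pi * Real.Gamma (a + 1) / Real.Gamma (a + 3 / 2) := by
  have h1 : sliceIntegral a = 2 * ∫ x in (0 : ℝ)..1, (1 - (2 * x - 1) ^ 2) ^ a := by
    rw [intervalIntegral.integral_comp_mul_sub (fun t : ℝ => (1 - t ^ 2) ^ a) two_ne_zero,
      sliceIntegral]
    norm_num
    ring
  have h2 : ∫ x in (0 : ℝ)..1, (1 - (2 * x - 1) ^ 2) ^ a =
      ∫ x in (0 : ℝ)..1, (4 : ℝ) ^ a * (x ^ a * (1 - x) ^ a) := by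
    refine intervalIntegral.integral_congr fun x hx => ?_
    rw [uIcc_of_le zero_le_one] at hx
    have hx1 : 0 ≤ 1 - x := by linarith [hx.2]
    rw [← Real.mul_rpow hx.1 hx1, ← Real.mul_rpow (by norm_num) (mul_nonneg hx.1 hx1)]
    congr 1
    ring
  rw [h1, h2, intervalIntegral.integral_const_mul, integral_rpow_mul_one_sub_rpow ha ha]
  have h3 := Real.Gamma_mul_Gamma_add_half (a + 1)
  rw [show a + 1 + 1 / 2 = a + 3 / 2 by ring, show 2 * (a + 1) = a + a + 2 by ring] at h3
  have g1 : 0 < Real.Gamma (a + 3 / 2) := Real.Gamma_pos_of_pos (by linarith)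
  have g2 : 0 < Real.Gamma (a + a + 2) := Real.Gamma_pos_of_pos (by linarith)
  have h4 : (2 : ℝ) ^ (1 - (a + a + 2)) * (2 * 4 ^ a) = 1 := by
    rw [show (4 : ℝ) = 2 ^ (2 : ℝ) by norm_num, ← Real.rpow_mul (by norm_num)]
    have h5 : (2 : ℝ) * 2 ^ (2 * a) = 2 ^ (2 * a + 1) := by
      rw [Real.rpow_add two_pos, Real.rpow_one, mul_comm]
    rw [h5, ← Real.rpow_add two_pos, show 1 - (a + a + 2) + (2 * a + 1) = 0 by ring,
      Real.rpow_zero]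
  rw [← mul_assoc, mul_div_assoc', div_eq_div_iff g2.ne' g1.ne']
  calc _ = 2 * 4 ^ a * Real.Gamma (a + 1) * (Real.Gamma (a + 1) * Real.Gamma (a + 3 / 2)) := by ring
    _ = (2 : ℝ) ^ (1 - (a + a + 2)) * (2 * 4 ^ a) *
        (√Real.pi * Real.Gamma (a + 1) * Real.Gamma (a + a + 2)) := by rw [h3]; ring
    _ = _ := by rw [h4, one_mul]

theorem sliceIntegral_pos {a : ℝ} (ha : 0 ≤ a) : 0 < sliceIntegral a := by
  rw [sliceIntegral_eq ha]
  have g1 : 0 < Real.Gamma (a + 3 / 2) := Real.Gamma_pos_of_pos (by linarith)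
  have g2 : 0 < Real.Gamma (a + 1) := Real.Gamma_pos_of_pos (by linarith)
  have := Real.pi_pos
  positivity

theorem continuous_one_sub_sq_rpow {a : ℝ} (ha : 0 ≤ a) :
    Continuous fun t : ℝ => (1 - t ^ 2) ^ a :=
  (by fun_prop : Continuous fun t : ℝ => 1 - t ^ 2).rpow_const fun _ => Or.inr ha

/-- Writing `t² = 1 - (1 - t²)` gives a difference of two slice integrals, whose ratio follows from
the recursion of `Γ`. -/
theorem integral_one_sub_sq_rpow_mul_sq {a : ℝ} (ha : 0 ≤ a) :
    ∫ t in (-1 : ℝ)..1, (1 - t ^ 2) ^ a * t ^ 2 = sliceIntegral a / (2 * a + 3) := by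
  have h1 : ∫ t in (-1 : ℝ)..1, (1 - t ^ 2) ^ a * t ^ 2 =
      sliceIntegral a - sliceIntegral (a + 1) := by
    rw [sliceIntegral, sliceIntegral, ← intervalIntegral.integral_sub
      ((continuous_one_sub_sq_rpow ha).intervalIntegrable _ _)
      ((continuous_one_sub_sq_rpow (by linarith)).intervalIntegrable _ _)]
    refine intervalIntegral.integral_congr fun t ht => ?_
    rw [uIcc_of_le (by norm_num)] at ht
    rw [Real.rpow_add_one' (by nlinarith [ht.1, ht.2]) (by linarith)]
    ring
  have g1 : 0 < Real.Gamma (a + 3 / 2) := Real.Gamma_pos_of_pos (by linarith)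
  have g2 : 0 < Real.Gamma (a + 1) := Real.Gamma_pos_of_pos (by linarith)
  rw [h1, sliceIntegral_eq ha, sliceIntegral_eq (by linarith : 0 ≤ a + 1),
    Real.Gamma_add_one (by linarith : a + 1 ≠ 0), show a + 1 + 3 / 2 = a + 3 / 2 + 1 by ring,
    Real.Gamma_add_one (by linarith : a + 3 / 2 ≠ 0)]
  have h2 : a + 3 / 2 ≠ 0 := by linarith
  have h3 : 2 * a + 3 ≠ 0 := by linarith
  set A := Real.Gamma (a + 1)
  set B := Real.Gamma (a + 3 / 2)
  field_simp
  ring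

theorem integral_one_sub_sq_rpow_mul_self {a : ℝ} (ha : 0 ≤ a) (c : ℝ) :
    ∫ t in (-1 : ℝ)..c, (1 - t ^ 2) ^ a * t = -(1 - c ^ 2) ^ (a + 1) / (2 * (a + 1)) := by
  have hd : ∀ t ∈ uIcc (-1) c, HasDerivAt (fun t : ℝ => -(1 - t ^ 2) ^ (a + 1) / (2 * (a + 1)))
      ((1 - t ^ 2) ^ a * t) t := by
    intro t _
    have h1 : HasDerivAt (fun t : ℝ => 1 - t ^ 2) (-(2 * t)) t := by
      simpa using ((hasDerivAt_id t).pow 2).const_sub 1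
    have h2 := (h1.rpow_const (p := a + 1) (Or.inr (by linarith))).neg.div_const (2 * (a + 1))
    convert! h2 using 1
    rw [add_sub_cancel_right]
    have : a + 1 ≠ 0 := by linarith
    field_simp
  rw [intervalIntegral.integral_eq_sub_of_hasDerivAt hd
    (((continuous_one_sub_sq_rpow ha).mul continuous_id).intervalIntegrable _ _)]
  have : (1 - (-1 : ℝ) ^ 2) ^ (a + 1) = 0 := by
    norm_num
    exact Real.zero_rpow (by linarith)
  rw [this]
  simp

variable {E : Type*} [NormedAddCommGroup E] [InnerProductSpace ℝ E] [FiniteDimensional ℝ E]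
  [MeasurableSpace E] [BorelSpace E]

theorem integrableOn_ball_of_abs_le {f : E → ℝ} {C : ℝ} (hf : Measurable f)
    (hC : ∀ w ∈ ball (0 : E) 1, |f w| ≤ C) : IntegrableOn f (ball 0 1) :=
  Measure.integrableOn_of_bounded measure_ball_lt_top.ne hf.aestronglyMeasurable
    ((ae_restrict_iff' measurableSet_ball).2 (Eventually.of_forall hC))

omit [FiniteDimensional ℝ E] [MeasurableSpace E] [BorelSpace E] in
theorem abs_inner_le_one_of_mem_ball {n w : E} (hn : ‖n‖ = 1) (hw : w ∈ ball (0 : E) 1) :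
    |⟪n, w⟫| ≤ 1 := by
  have h1 := abs_real_inner_le_norm n w
  rw [mem_ball_zero_iff] at hw
  rw [hn, one_mul] at h1
  linarith

/-- The marginal of the unit ball in the direction of a unit vector. -/
theorem setIntegral_ball_inner {n : E} (hn : ‖n‖ = 1) {f : ℝ → ℝ} {C : ℝ} (hf : Measurable f)
    (hC : ∀ t, |t| ≤ 1 → |f t| ≤ C) :
    ∫ w in ball (0 : E) 1, f ⟪n, w⟫ = volume.real (ball (0 : (ℝ ∙ n)ᗮ) 1) *
      ∫ t in (-1 : ℝ)..1, (1 - t ^ 2) ^ (((finrank ℝ E : ℝ) - 1) / 2) * f t := by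
  have hfr : (finrank ℝ (ℝ ∙ n)ᗮ : ℝ) = finrank ℝ E - 1 := by
    have h1 := (ℝ ∙ n).finrank_add_finrank_orthogonal
    rw [finrank_span_singleton (norm_ne_zero_iff.1 (by rw [hn]; exact one_ne_zero))] at h1
    rw [← h1]
    push_cast
    ring
  have hint : IntegrableOn (fun w => f ⟪n, w⟫) (ball (0 : E) 1) :=
    integrableOn_ball_of_abs_le (hf.comp (by fun_prop)) fun w hw =>
      hC _ (abs_inner_le_one_of_mem_ball hn hw)
  have hint' := (integrable_indicator_iff measurableSet_ball).2 hint
  have hmp := measurePreserving_orthogonalCoordinates n hn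
  have hemb := (orthogonalCoordinates n hn).measurableEmbedding
  have hi2 : Integrable (fun q => (ball (0 : E) 1).indicator (fun w => f ⟪n, w⟫)
      (orthogonalCoordinates n hn q)) volume := (hmp.integrable_comp_emb hemb).2 hint'
  rw [← integral_indicator measurableSet_ball, ← hmp.integral_comp hemb]
  rw [Measure.volume_eq_prod] at hi2 ⊢
  rw [integral_prod_symm _ hi2, ← intervalIntegral.integral_const_mul,
    intervalIntegral.integral_of_le (by norm_num),
    ← integral_indicator measurableSet_Ioc]
  refine integral_congr_ae ?_
  -- The endpoint `1` lies in `Ioc (-1) 1` but its slice of the open ball is empty; it is a null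
  -- set.
  have hne : ∀ᵐ t : ℝ, t ≠ 1 := by simp [ae_iff, measure_singleton]
  filter_upwards [hne] with t ht
  have hmem : ∀ v : (ℝ ∙ n)ᗮ, orthogonalCoordinates n hn (v, t) ∈ ball (0 : E) 1 ↔
      ‖v‖ ^ 2 < 1 - t ^ 2 := fun v => by
    rw [orthogonalCoordinates_apply, mem_ball_zero_iff, ← sq_lt_one_iff₀ (norm_nonneg _),
      norm_orthogonal_add_smul_sq hn, lt_sub_iff_add_lt]
  by_cases hpos : 0 < 1 - t ^ 2
  · have hIoc : t ∈ Ioc (-1 : ℝ) 1 := ⟨by nlinarith, by nlinarith⟩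
    rw [indicator_of_mem hIoc]
    have hball : ∀ v : (ℝ ∙ n)ᗮ, (ball (0 : E) 1).indicator (fun w => f ⟪n, w⟫)
        (orthogonalCoordinates n hn (v, t)) =
        (ball (0 : (ℝ ∙ n)ᗮ) √(1 - t ^ 2)).indicator (fun _ => f t) v := fun v => by
      have h1 : orthogonalCoordinates n hn (v, t) ∈ ball (0 : E) 1 ↔
          v ∈ ball (0 : (ℝ ∙ n)ᗮ) √(1 - t ^ 2) := by
        rw [hmem, mem_ball_zero_iff, Real.lt_sqrt (norm_nonneg _)]
      by_cases hv : v ∈ ball (0 : (ℝ ∙ n)ᗮ) √(1 - t ^ 2)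
      · rw [indicator_of_mem hv, indicator_of_mem (h1.2 hv), orthogonalCoordinates_apply,
          inner_orthogonal_add_smul hn]
      · rw [indicator_of_notMem hv, indicator_of_notMem fun h => hv (h1.1 h)]
    simp_rw [hball]
    rw [integral_indicator measurableSet_ball, setIntegral_const, smul_eq_mul, measureReal_def,
      Measure.addHaar_ball_of_pos _ _ (Real.sqrt_pos.2 hpos), ENNReal.toReal_mul,
      ENNReal.toReal_ofReal (by positivity), ← measureReal_def, ← Real.rpow_natCast,
      Real.sqrt_eq_rpow, ← Real.rpow_mul hpos.le, hfr,
      show 1 / 2 * ((finrank ℝ E : ℝ) - 1) = ((finrank ℝ E : ℝ) - 1) / 2 by ring]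
    ring
  · have hIoc : t ∉ Ioc (-1 : ℝ) 1 := fun h => hpos (by
      have : t < 1 := lt_of_le_of_ne h.2 ht
      nlinarith [h.1])
    rw [indicator_of_notMem hIoc]
    have hball : ∀ v : (ℝ ∙ n)ᗮ, (ball (0 : E) 1).indicator (fun w => f ⟪n, w⟫)
        (orthogonalCoordinates n hn (v, t)) = 0 := fun v => by
      refine indicator_of_notMem (fun h => ?_) _
      have := (hmem v).1 h
      nlinarith [sq_nonneg ‖v‖]
    simp [hball]

theorem setAverage_ball_inner {n : E} (hn : ‖n‖ = 1) {f : ℝ → ℝ} {C : ℝ} (hf : Measurable f)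
    (hC : ∀ t, |t| ≤ 1 → |f t| ≤ C) :
    ⨍ w in ball (0 : E) 1, f ⟪n, w⟫ = (sliceIntegral (((finrank ℝ E : ℝ) - 1) / 2))⁻¹ *
      ∫ t in (-1 : ℝ)..1, (1 - t ^ 2) ^ (((finrank ℝ E : ℝ) - 1) / 2) * f t := by
  -- The constant function gives the volume of the ball, and the volume of the hyperplane ball then
  -- cancels.
  have h1 := setIntegral_ball_inner hn (f := fun _ => 1) (C := 1) measurable_const (by simp)
  simp only [mul_one, setIntegral_const, smul_eq_mul] at h1
  have hv : volume.real (ball (0 : (ℝ ∙ n)ᗮ) 1) ≠ 0 :=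
    (ENNReal.toReal_pos (measure_ball_pos _ _ one_pos).ne' measure_ball_lt_top.ne).ne'
  rw [setAverage_eq, setIntegral_ball_inner hn hf hC, h1, smul_eq_mul, mul_inv, sliceIntegral]
  field_simp

end BallIntegrals

/-! ### First moments of half-spaces over the ball, and the constant. -/

section BallAverages

open Module Set Metric
open scoped ENNReal NNReal RealInnerProductSpace

variable {E : Type*} [NormedAddCommGroup E] [InnerProductSpace ℝ E] [FiniteDimensional ℝ E]
  [MeasurableSpace E] [BorelSpace E]

/-- Reflection in the hyperplane orthogonal to `u` preserves the ball and fixes `n` but reverses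
`u`, so the integral equals its negative. -/
theorem setIntegral_ball_inner_mul_eq_zero {u n : E} (hun : ⟪u, n⟫ = 0) (φ : ℝ → ℝ) :
    ∫ w in ball (0 : E) 1, ⟪u, w⟫ * φ ⟪n, w⟫ = 0 := by
  set R := (ℝ ∙ u)ᗮ.reflection
  have hRu : R u = -u := by
    refine Submodule.reflection_mem_subspace_orthogonal_precomplement_eq_neg ?_
    exact Submodule.mem_span_singleton_self u
  have hRn : R n = n := by
    rw [Submodule.reflection_eq_self_iff, Submodule.mem_orthogonal_singleton_iff_inner_right, hun]
  have h1 := R.measurePreserving.setIntegral_preimage_emb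
    R.toHomeomorph.measurableEmbedding (fun w => ⟪u, w⟫ * φ ⟪n, w⟫) (ball 0 1)
  rw [LinearIsometryEquiv.preimage_ball, map_zero] at h1
  have hR : ∀ v w, ⟪v, R w⟫ = ⟪R v, w⟫ := fun v w => by
    rw [← R.inner_map_map v (R w), Submodule.reflection_reflection]
  have h2 : ∀ w, ⟪u, R w⟫ * φ ⟪n, R w⟫ = -(⟪u, w⟫ * φ ⟪n, w⟫) := fun w => by
    have h3 : ⟪u, R w⟫ = -⟪u, w⟫ := by
      rw [hR, hRu, inner_neg_left]
    have h4 : ⟪n, R w⟫ = ⟪n, w⟫ := by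
      rw [hR, hRn]
    rw [h3, h4, neg_mul]
  simp_rw [h2] at h1
  rw [integral_neg] at h1
  linarith

/-- Averages over the unit ball against functions of one coordinate only see that coordinate. -/
theorem setAverage_ball_inner_mul (u : E) {n : E} (hn : ‖n‖ = 1) {φ : ℝ → ℝ} {C : ℝ}
    (hφ : Measurable φ) (hC : ∀ t, |t| ≤ 1 → |φ t| ≤ C) :
    ⨍ w in ball (0 : E) 1, ⟪u, w⟫ * φ ⟪n, w⟫ =
      ⟪u, n⟫ * ⨍ w in ball (0 : E) 1, ⟪n, w⟫ * φ ⟪n, w⟫ := by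
  have hi : ∀ v : E, IntegrableOn (fun w => ⟪v, w⟫ * φ ⟪n, w⟫) (ball (0 : E) 1) := fun v => by
    refine integrableOn_ball_of_abs_le (C := ‖v‖ * C)
      ((by fun_prop : Measurable fun w => ⟪v, w⟫).mul (hφ.comp (by fun_prop))) fun w hw => ?_
    rw [abs_mul]
    have h1 := abs_real_inner_le_norm v w
    have h2 : ‖w‖ ≤ 1 := (mem_ball_zero_iff.1 hw).le
    refine mul_le_mul (h1.trans (mul_le_of_le_one_right (norm_nonneg _) h2))
      (hC _ (abs_inner_le_one_of_mem_ball hn hw)) (abs_nonneg _) (norm_nonneg _)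
  -- Only the component of `u` along `n` survives; the rest is orthogonal to `n` and integrates to
  -- zero.
  have h0 := setIntegral_ball_inner_mul_eq_zero (u := u - ⟪u, n⟫ • n) (n := n) (by
    rw [inner_sub_left, inner_smul_left, real_inner_self_eq_norm_sq, hn]
    simp) φ
  have h1 : ∀ w, ⟪u - ⟪u, n⟫ • n, w⟫ * φ ⟪n, w⟫ =
      ⟪u, w⟫ * φ ⟪n, w⟫ - ⟪u, n⟫ * (⟪n, w⟫ * φ ⟪n, w⟫) := fun w => by
    rw [inner_sub_left, inner_smul_left]
    simp
    ring
  simp_rw [h1] at h0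
  rw [integral_sub (hi u) ((hi n).const_mul _), integral_const_mul, sub_eq_zero] at h0
  rw [setAverage_eq, setAverage_eq, h0, smul_eq_mul, smul_eq_mul]
  ring

omit [MeasurableSpace E] [BorelSpace E] in
theorem finrank_pos_of_norm_eq_one {n : E} (hn : ‖n‖ = 1) : 1 ≤ (finrank ℝ E : ℝ) := by
  have : Nontrivial E := ⟨n, 0, fun h => by simp [h] at hn⟩
  exact_mod_cast finrank_pos (R := ℝ) (M := E)

/-- This is `E[w wᵀ] = (d + 2)⁻¹ • 1`: for the exponent `a = (d - 1) / 2` of the marginal, `2a + 3 =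
d + 2`. -/
theorem setAverage_ball_inner_mul_inner (u : E) {n : E} (hn : ‖n‖ = 1) :
    ⨍ w in ball (0 : E) 1, ⟪u, w⟫ * ⟪n, w⟫ = ⟪u, n⟫ / (finrank ℝ E + 2) := by
  have hd := finrank_pos_of_norm_eq_one hn
  have ha : 0 ≤ ((finrank ℝ E : ℝ) - 1) / 2 := by linarith
  rw [setAverage_ball_inner_mul u hn (φ := fun t => t) (C := 1) measurable_id fun t ht => ht,
    setAverage_ball_inner hn (f := fun t => t * t) (C := 1) (by fun_prop) fun t ht => by
      rw [abs_mul]; nlinarith [abs_nonneg t]]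
  have h1 := integral_one_sub_sq_rpow_mul_sq ha
  simp_rw [← sq]
  rw [h1]
  have := (sliceIntegral_pos ha).ne'
  have h2 : 2 * (((finrank ℝ E : ℝ) - 1) / 2) + 3 = finrank ℝ E + 2 := by ring
  rw [h2]
  field_simp

/-- The size of the regression signal at signed distance `σ` from a flat jump, in dimension `d`,
up to normalization. -/
noncomputable def jumpProfile (d : ℕ) (σ : ℝ) : ℝ :=
  max (1 - σ ^ 2) 0 ^ (((d : ℝ) + 1) / 2) / ((d + 1) * sliceIntegral (((d : ℝ) - 1) / 2))

/-- The half-space stops the marginal integral at `c`, the clamp of `-σ` to `[-1, 1]`. The primitive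
depends on `1 - c²`, which is `max (1 - σ²) 0`, so planes missing the ball contribute nothing. -/
theorem setAverage_ball_inner_mul_indicator {n : E} (hn : ‖n‖ = 1) (σ : ℝ) :
    ⨍ w in ball (0 : E) 1, ⟪n, w⟫ * (Iic (0 : ℝ)).indicator (fun _ => 1) (σ + ⟪n, w⟫) =
      -jumpProfile (finrank ℝ E) σ := by
  have hd := finrank_pos_of_norm_eq_one hn
  have ha : 0 ≤ ((finrank ℝ E : ℝ) - 1) / 2 := by linarith
  set a := ((finrank ℝ E : ℝ) - 1) / 2 with ha'
  have hind : Measurable fun t : ℝ => (Iic (0 : ℝ)).indicator (fun _ => (1 : ℝ)) (σ + t) :=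
    (measurable_const.indicator measurableSet_Iic).comp (by fun_prop)
  rw [setAverage_ball_inner hn
    (f := fun t => t * (Iic (0 : ℝ)).indicator (fun _ => 1) (σ + t)) (C := 1)
    (measurable_id.mul hind) fun t ht => by
      simp only [indicator]
      split_ifs <;> simp [ht]]
  set c := max (-1) (min 1 (-σ)) with hc
  have hc1 : -1 ≤ c := le_max_left _ _
  have hc2 : c ≤ 1 := max_le (by norm_num) (min_le_left _ _)
  have h1 : ∫ t in (-1 : ℝ)..1, (1 - t ^ 2) ^ a *
      (t * (Iic (0 : ℝ)).indicator (fun _ => 1) (σ + t)) =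
      ∫ t in (-1 : ℝ)..c, (1 - t ^ 2) ^ a * t := by
    rw [intervalIntegral.integral_of_le (by norm_num), intervalIntegral.integral_of_le hc1,
      ← integral_indicator measurableSet_Ioc, ← integral_indicator measurableSet_Ioc]
    congr 1
    ext t
    by_cases ht : t ∈ Ioc (-1) c
    · have h2 : t ≤ min 1 (-σ) := (le_max_iff.1 ht.2).resolve_left (not_le.2 ht.1)
      have h3 : t ∈ Ioc (-1 : ℝ) 1 := ⟨ht.1, ht.2.trans hc2⟩
      have h4 : σ + t ∈ Iic (0 : ℝ) := by
        have := h2.trans (min_le_right _ _)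
        simp only [mem_Iic]
        linarith
      rw [indicator_of_mem ht, indicator_of_mem h3, indicator_of_mem h4, mul_one]
    · rw [indicator_of_notMem ht]
      by_cases h3 : t ∈ Ioc (-1 : ℝ) 1
      · have h4 : σ + t ∉ Iic (0 : ℝ) := fun h4 => by
          simp only [mem_Iic] at h4
          exact ht ⟨h3.1, le_max_of_le_right (le_min h3.2 (by linarith))⟩
        rw [indicator_of_mem h3, indicator_of_notMem h4, mul_zero, mul_zero]
      · rw [indicator_of_notMem h3]
  have hc3 : 1 - c ^ 2 = max (1 - σ ^ 2) 0 := by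
    rcases le_total σ (-1) with h | h
    · rw [hc, min_eq_left (by linarith), max_eq_right (by norm_num), max_eq_right (by nlinarith)]
      norm_num
    rcases le_total σ 1 with h' | h'
    · rw [hc, min_eq_right (by linarith), max_eq_right (by linarith), max_eq_left (by nlinarith)]
      ring
    · rw [hc, min_eq_right (by linarith), max_eq_left (by linarith), max_eq_right (by nlinarith)]
      norm_num
  have h5 : a + 1 = ((finrank ℝ E : ℝ) + 1) / 2 := by rw [ha']; ring
  rw [h1, integral_one_sub_sq_rpow_mul_self ha, hc3, jumpProfile, ← ha', h5]
  have := (sliceIntegral_pos ha).ne'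
  field_simp

/-- Dividing by `‖p‖` does not change which side of the plane a point is on and reduces to a unit
normal. -/
theorem setAverage_ball_inner_mul_indicator_add_inner (u : E) {p : E} (hp : p ≠ 0) (s : ℝ) :
    ⨍ w in ball (0 : E) 1, ⟪u, w⟫ * (Iic (0 : ℝ)).indicator (fun _ => 1) (s + ⟪p, w⟫) =
      -(⟪u, p⟫ / ‖p‖ * jumpProfile (finrank ℝ E) (s / ‖p‖)) := by
  have hp' : 0 < ‖p‖ := norm_pos_iff.2 hp
  set n := ‖p‖⁻¹ • p with hn'
  have hn : ‖n‖ = 1 := by rw [hn', norm_smul, norm_inv, norm_norm, inv_mul_cancel₀ hp'.ne']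
  have h1 : ∀ w, (Iic (0 : ℝ)).indicator (fun _ => (1 : ℝ)) (s + ⟪p, w⟫) =
      (Iic (0 : ℝ)).indicator (fun _ => 1) (s / ‖p‖ + ⟪n, w⟫) := fun w => by
    have h2 : s / ‖p‖ + ⟪n, w⟫ = ‖p‖⁻¹ * (s + ⟪p, w⟫) := by
      rw [hn', inner_smul_left]
      simp
      ring
    rw [h2]
    by_cases h : s + ⟪p, w⟫ ≤ 0
    · rw [indicator_of_mem (by exact h), indicator_of_mem]
      exact mul_nonpos_of_nonneg_of_nonpos (inv_pos.2 hp').le h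
    · rw [indicator_of_notMem (by exact h), indicator_of_notMem]
      exact not_le.2 (mul_pos (inv_pos.2 hp') (not_le.1 h))
  simp_rw [h1]
  have hind : Measurable fun t : ℝ => (Iic (0 : ℝ)).indicator (fun _ => (1 : ℝ)) (s / ‖p‖ + t) :=
    (measurable_const.indicator measurableSet_Iic).comp (by fun_prop)
  rw [setAverage_ball_inner_mul u hn
    (φ := fun t => (Iic (0 : ℝ)).indicator (fun _ => 1) (s / ‖p‖ + t)) (C := 1) hind
    (fun t _ => by
      simp only [indicator]
      split_ifs <;> simp), setAverage_ball_inner_mul_indicator hn, hn', inner_smul_right]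
  ring

/-- Squaring doubles the exponent `(d + 1) / 2`, leaving a slice integral. The factor `b = ‖∇h‖` is
what later cancels `‖∇h‖⁻¹` in the concentration formula. -/
theorem integral_jumpProfile_sq (d : ℕ) {b : ℝ} (hb : 0 < b) :
    ∫ s, jumpProfile d (s / b) ^ 2 =
      b * (sliceIntegral (d + 1) / ((d + 1) * sliceIntegral (((d : ℝ) - 1) / 2)) ^ 2) := by
  rw [Measure.integral_comp_div (fun s => jumpProfile d s ^ 2), abs_of_pos hb, smul_eq_mul]
  congr 1
  have h1 : ∀ s : ℝ, jumpProfile d s ^ 2 = (Ioc (-1 : ℝ) 1).indicator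
      (fun s => (1 - s ^ 2) ^ ((d : ℝ) + 1)) s /
        ((d + 1) * sliceIntegral (((d : ℝ) - 1) / 2)) ^ 2 := fun s => by
    rw [jumpProfile, div_pow, ← Real.rpow_natCast (max (1 - s ^ 2) 0 ^ _),
      ← Real.rpow_mul (le_max_right _ _)]
    have h2 : ((d : ℝ) + 1) / 2 * (2 : ℕ) = d + 1 := by push_cast; ring
    rw [h2]
    congr 1
    by_cases hs : s ∈ Ioc (-1 : ℝ) 1
    · rw [indicator_of_mem hs, max_eq_left]
      nlinarith [hs.1, hs.2]
    · rw [indicator_of_notMem hs, max_eq_right, Real.zero_rpow (by positivity)]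
      rw [mem_Ioc, not_and_or, not_lt, not_le] at hs
      rcases hs with hs | hs <;> nlinarith
  simp_rw [h1]
  rw [integral_div, integral_indicator measurableSet_Ioc, sliceIntegral.eq_def (d + 1),
    intervalIntegral.integral_of_le (by norm_num)]

/-- The factors `P + 1` and `P + 2` are absorbed by the recursion of `Γ` at `(P + 1) / 2` and `(P +
2) / 2`; what remains is the reciprocal of `A_P`. -/
theorem jumpConst_mul_eq_one {P : ℕ} (hP : 1 ≤ P) :
    jumpConst P * (((P : ℝ) + 2) ^ 2 *
      (sliceIntegral (P + 1) / ((P + 1) * sliceIntegral (((P : ℝ) - 1) / 2)) ^ 2)) = 1 := by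
  have hP' : (1 : ℝ) ≤ P := by exact_mod_cast hP
  rw [sliceIntegral_eq (by linarith), sliceIntegral_eq (by linarith), jumpConst]
  have e1 : ((P : ℝ) - 1) / 2 + 1 = (P + 1) / 2 := by ring
  have e2 : ((P : ℝ) - 1) / 2 + 3 / 2 = (P + 2) / 2 := by ring
  have e3 : ((P : ℝ) + 3) / 2 = (P + 1) / 2 + 1 := by ring
  have e4 : ((P : ℝ) + 4) / 2 = (P + 2) / 2 + 1 := by ring
  have e5 : (P : ℝ) + 1 + 1 = P + 2 := by ring
  have e6 : (P : ℝ) + 1 + 3 / 2 = P + 5 / 2 := by ring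
  rw [e1, e2, e3, e4, e5, e6, Real.Gamma_add_one (by positivity),
    Real.Gamma_add_one (by positivity)]
  have g1 := Real.Gamma_pos_of_pos (show 0 < ((P : ℝ) + 1) / 2 by linarith)
  have g2 := Real.Gamma_pos_of_pos (show 0 < ((P : ℝ) + 2) / 2 by linarith)
  have g3 := Real.Gamma_pos_of_pos (show 0 < (P : ℝ) + 2 by linarith)
  have g4 := Real.Gamma_pos_of_pos (show 0 < (P : ℝ) + 5 / 2 by linarith)
  have hpi : 0 < √Real.pi := Real.sqrt_pos.2 Real.pi_pos
  set A := Real.Gamma (((P : ℝ) + 1) / 2)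
  set B := Real.Gamma (((P : ℝ) + 2) / 2)
  set C := Real.Gamma ((P : ℝ) + 2)
  set D := Real.Gamma ((P : ℝ) + 5 / 2)
  set q := √Real.pi
  have h2 : (P : ℝ) + 2 ≠ 0 := by linarith
  have h1 : (P : ℝ) + 1 ≠ 0 := by linarith
  field_simp

end BallAverages

/-! ### Local moments: bounds, measurability, and blow-up at a jump. -/

section BallMoment

open Module Set Metric
open scoped ENNReal NNReal RealInnerProductSpace

variable {E : Type*} [NormedAddCommGroup E] [InnerProductSpace ℝ E] [FiniteDimensional ℝ E]
  [MeasurableSpace E] [BorelSpace E]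

/-- The first moment `E[⟪u, w⟫ F(x + r w)]` with `w` uniform on the unit ball. -/
noncomputable def ballMoment (F : E → ℝ) (u : E) (r : ℝ) (x : E) : ℝ :=
  ⨍ w in ball (0 : E) 1, ⟪u, w⟫ * F (x + r • w)

/-- The indicator function of the region `h ≤ 0`. -/
noncomputable def stepFunction {E : Type*} (h : E → ℝ) : E → ℝ := {y | h y ≤ 0}.indicator fun _ => 1

theorem stepFunction_apply {E : Type*} (h : E → ℝ) (x : E) :
    stepFunction h x = (Iic (0 : ℝ)).indicator (fun _ => 1) (h x) := rfl

theorem abs_stepFunction_le {E : Type*} (h : E → ℝ) (x : E) : |stepFunction h x| ≤ 1 := by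
  simp only [stepFunction, indicator]
  split_ifs <;> simp

omit [InnerProductSpace ℝ E] [FiniteDimensional ℝ E] in
theorem measurable_indicator_stepFunction {h : E → ℝ} {K : Set E} (hK : IsCompact K)
    (hh : ContinuousOn h K) : Measurable (K.indicator (stepFunction h)) := by
  rw [stepFunction, indicator_indicator]
  exact measurable_const.indicator
    (hh.preimage_isClosed_of_isClosed hK.isClosed isClosed_Iic).measurableSet

omit [InnerProductSpace ℝ E] [FiniteDimensional ℝ E] in
theorem ContinuousOn.measurable_indicator {h : E → ℝ} {K : Set E} (hK : MeasurableSet K)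
    (hh : ContinuousOn h K) : Measurable (K.indicator h) := by
  classical
  rw [← piecewise_eq_indicator]
  exact hh.measurable_piecewise continuousOn_const hK

theorem integrableOn_ball_inner_mul {F : E → ℝ} {K : Set E} {C : ℝ}
    (hF : Measurable (K.indicator F)) (hC : ∀ x ∈ K, |F x| ≤ C) (u : E) {r : ℝ} {x : E}
    (hx : ∀ w ∈ ball (0 : E) 1, x + r • w ∈ K) :
    IntegrableOn (fun w => ⟪u, w⟫ * F (x + r • w)) (ball 0 1) := by
  have h1 : IntegrableOn (fun w => ⟪u, w⟫ * K.indicator F (x + r • w)) (ball 0 1) := by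
    refine integrableOn_ball_of_abs_le (C := ‖u‖ * C)
      ((by fun_prop : Measurable fun w => ⟪u, w⟫).mul (hF.comp (by fun_prop))) fun w hw => ?_
    rw [abs_mul, indicator_of_mem (hx w hw)]
    have h1 := abs_real_inner_le_norm u w
    have h2 : ‖w‖ ≤ 1 := (mem_ball_zero_iff.1 hw).le
    exact mul_le_mul (h1.trans (mul_le_of_le_one_right (norm_nonneg _) h2))
      (hC _ (hx w hw)) (abs_nonneg _) (norm_nonneg _)
  refine h1.congr_fun (fun w hw => ?_) measurableSet_ball
  simp only [indicator_of_mem (hx w hw)]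

theorem abs_ballMoment_le {F : E → ℝ} {C : ℝ} (u : E) {r : ℝ} {x : E}
    (hC : ∀ w ∈ ball (0 : E) 1, |F (x + r • w)| ≤ C) : |ballMoment F u r x| ≤ ‖u‖ * C := by
  have hvol : 0 < volume.real (ball (0 : E) 1) :=
    ENNReal.toReal_pos (measure_ball_pos _ _ one_pos).ne' measure_ball_lt_top.ne
  have h1 : ‖∫ w in ball (0 : E) 1, ⟪u, w⟫ * F (x + r • w)‖ ≤
      ‖u‖ * C * volume.real (ball (0 : E) 1) := by
    refine norm_setIntegral_le_of_norm_le_const measure_ball_lt_top fun w hw => ?_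
    rw [norm_mul]
    have h1 := abs_real_inner_le_norm u w
    have h2 : ‖w‖ ≤ 1 := (mem_ball_zero_iff.1 hw).le
    exact mul_le_mul (h1.trans (mul_le_of_le_one_right (norm_nonneg _) h2))
      (hC w hw) (abs_nonneg _) (norm_nonneg _)
  rw [ballMoment, setAverage_eq, smul_eq_mul, abs_mul, abs_of_pos (inv_pos.2 hvol),
    inv_mul_le_iff₀ hvol, mul_comm _ (‖u‖ * C)]
  exact h1

theorem setIntegral_ball_inner_eq_zero (u : E) : ∫ w in ball (0 : E) 1, ⟪u, w⟫ = 0 := by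
  simpa using setIntegral_ball_inner_mul_eq_zero (inner_zero_right u) (fun _ => 1)

theorem ballMoment_eq_zero_of_const {F : E → ℝ} {c : ℝ} (u : E) {r : ℝ} {x : E}
    (hF : ∀ w ∈ ball (0 : E) 1, F (x + r • w) = c) : ballMoment F u r x = 0 := by
  rw [ballMoment, setAverage_eq, setIntegral_congr_fun (g := fun w => ⟪u, w⟫ * c)
    measurableSet_ball fun w hw => by simp only [hF w hw], integral_mul_const,
    setIntegral_ball_inner_eq_zero, zero_mul, smul_zero]

theorem ballMoment_sum {ι : Type*} (s : Finset ι) (c : ι → ℝ) {F : ι → E → ℝ} (u : E) {r : ℝ}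
    {x : E} (hF : ∀ i ∈ s, IntegrableOn (fun w => ⟪u, w⟫ * F i (x + r • w)) (ball 0 1)) :
    ballMoment (fun y => ∑ i ∈ s, c i * F i y) u r x = ∑ i ∈ s, c i * ballMoment (F i) u r x := by
  have h1 : ∀ w, ⟪u, w⟫ * ∑ i ∈ s, c i * F i (x + r • w) =
      ∑ i ∈ s, c i * (⟪u, w⟫ * F i (x + r • w)) := fun w => by
    rw [Finset.mul_sum]
    exact Finset.sum_congr rfl fun i _ => by ring
  simp only [ballMoment, setAverage_eq, h1]
  rw [integral_finsetSum _ fun i hi => (hF i hi).const_mul _, Finset.smul_sum]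
  refine Finset.sum_congr rfl fun i _ => ?_
  rw [integral_const_mul, smul_eq_mul, smul_eq_mul]
  ring

/-- The ball is centred, so constants have zero moment and `F x` may be subtracted; thus the moment
of a `C¹` function is `O(r)`. -/
theorem abs_ballMoment_le_of_abs_sub_le {F : E → ℝ} {C : ℝ} (u : E) {r : ℝ} {x : E}
    (hF : IntegrableOn (fun w => ⟪u, w⟫ * F (x + r • w)) (ball 0 1))
    (hC : ∀ w ∈ ball (0 : E) 1, |F (x + r • w) - F x| ≤ C) : |ballMoment F u r x| ≤ ‖u‖ * C := by
  have h1 : ballMoment F u r x = ballMoment (fun y => F y - F x) u r x := by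
    rw [ballMoment, ballMoment, setAverage_eq, setAverage_eq]
    simp_rw [mul_sub]
    rw [integral_sub hF, integral_mul_const, setIntegral_ball_inner_eq_zero, zero_mul, sub_zero]
    exact (integrableOn_ball_of_abs_le (C := ‖u‖) (by fun_prop) fun w hw =>
      (abs_real_inner_le_norm u w).trans (mul_le_of_le_one_right (norm_nonneg _)
        (mem_ball_zero_iff.1 hw).le)).mul_const _
  rw [h1]
  exact abs_ballMoment_le u hC

/-- On `X` the moment sees `F` only inside `K`, so `F` may be replaced by the globally measurable
`K.indicator F` and integrated over a parameter. -/
theorem measurable_indicator_ballMoment {F : E → ℝ} {X K : Set E} (hX : MeasurableSet X)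
    (hF : Measurable (K.indicator F)) (u : E) {r : ℝ}
    (hx : ∀ x ∈ X, ∀ w ∈ ball (0 : E) 1, x + r • w ∈ K) :
    Measurable (X.indicator (ballMoment F u r)) := by
  have h1 : X.indicator (ballMoment F u r) = X.indicator (ballMoment (K.indicator F) u r) := by
    refine indicator_congr fun x hxX => ?_
    rw [ballMoment, ballMoment, setAverage_eq, setAverage_eq]
    congr 1
    refine setIntegral_congr_fun measurableSet_ball fun w hw => ?_
    simp only [indicator_of_mem (hx x hxX w hw)]
  rw [h1]
  refine Measurable.indicator ?_ hX
  have h2 : Measurable fun q : E × E => ⟪u, q.2⟫ * K.indicator F (q.1 + r • q.2) :=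
    (by fun_prop : Measurable fun q : E × E => ⟪u, q.2⟫).mul (hF.comp (by fun_prop))
  have h3 := (h2.stronglyMeasurable.integral_prod_right'
    (ν := volume.restrict (ball (0 : E) 1))).measurable
  have h4 : ballMoment (K.indicator F) u r = fun x => (volume.real (ball (0 : E) 1))⁻¹ *
      ∫ w in ball (0 : E) 1, ⟪u, w⟫ * K.indicator F (x + r • w) := by
    ext x
    rw [ballMoment, setAverage_eq, smul_eq_mul]
  rw [h4]
  exact h3.const_mul _

-- A closed thickening of `X` serves: one compact set inside `U` holds all small balls, so bounds on
-- it are uniform in the centre and in `r`.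
omit [MeasurableSpace E] [BorelSpace E] in
theorem exists_isCompact_forall_add_mem {X U : Set E} (hX : IsCompact X) (hU : IsOpen U)
    (hXU : X ⊆ U) : ∃ K ⊆ U, IsCompact K ∧ X ⊆ K ∧ ∀ᶠ r in 𝓝[>] (0 : ℝ), ∀ x ∈ X, ball x r ⊆ K := by
  obtain ⟨ρ, hρ, hsub⟩ := hX.exists_cthickening_subset_open hU hXU
  refine ⟨cthickening ρ X, hsub, hX.cthickening, self_subset_cthickening X, ?_⟩
  filter_upwards [Ioo_mem_nhdsGT hρ] with r hr x hx
  exact (ball_subset_closedBall.trans (closedBall_subset_closedBall hr.2.le)).trans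
    (closedBall_subset_cthickening hx ρ)

omit [InnerProductSpace ℝ E] [FiniteDimensional ℝ E] [MeasurableSpace E] [BorelSpace E] in
theorem add_smul_mem_ball [NormedSpace ℝ E] {r : ℝ} (hr : 0 < r) (x : E) {w : E}
    (hw : w ∈ ball (0 : E) 1) : x + r • w ∈ ball x r := by
  rw [mem_ball_iff_norm, add_sub_cancel_left, norm_smul, Real.norm_of_nonneg hr.le]
  exact mul_lt_of_lt_one_right hr (mem_ball_zero_iff.1 hw)

-- The mean value inequality is applied on each ball, which is convex while the compact set bounding
-- the derivative need not be.
omit [MeasurableSpace E] [BorelSpace E] in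
theorem exists_abs_sub_le_mul {h : E → ℝ} {X U : Set E} (hX : IsCompact X) (hU : IsOpen U)
    (hXU : X ⊆ U) (hh : ContDiffOn ℝ 1 h U) :
    ∃ L, ∀ᶠ r in 𝓝[>] (0 : ℝ), ∀ x ∈ X, ∀ w ∈ ball (0 : E) 1, |h (x + r • w) - h x| ≤ L * r := by
  obtain ⟨K, hKU, hK, -, hball⟩ := exists_isCompact_forall_add_mem hX hU hXU
  obtain ⟨L, hL⟩ := hK.exists_bound_of_continuousOn
    ((hh.continuousOn_fderiv_of_isOpen hU le_rfl).mono hKU)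
  refine ⟨max L 0, ?_⟩
  filter_upwards [hball, self_mem_nhdsWithin] with r hr hr0 x hx w hw
  have h1 := (convex_ball x r).norm_image_sub_le_of_norm_fderiv_le (f := h) (𝕜 := ℝ) (C := max L 0)
    (fun y hy => (hh.contDiffAt (hU.mem_nhds (hKU (hr x hx hy)))).differentiableAt one_ne_zero)
    (fun y hy => (hL y (hr x hx hy)).trans (le_max_left _ _)) (mem_ball_self hr0)
    (add_smul_mem_ball hr0 x hw)
  refine h1.trans (mul_le_mul_of_nonneg_left ?_ (le_max_right _ _))
  exact (mem_ball_iff_norm.1 (add_smul_mem_ball hr0 x hw)).le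

/-- If `|h x|` exceeds the oscillation, `h` keeps its sign on the ball and the step is constant
there. -/
theorem ballMoment_stepFunction_eq_zero {h : E → ℝ} {c : ℝ} (u : E) {r : ℝ} {x : E}
    (hc : ∀ w ∈ ball (0 : E) 1, |h (x + r • w) - h x| ≤ c) (hx : c < |h x|) :
    ballMoment (stepFunction h) u r x = 0 := by
  rcases le_or_gt (h x) 0 with h0 | h0
  · refine ballMoment_eq_zero_of_const (c := 1) u fun w hw => indicator_of_mem ?_ _
    have h1 := abs_le.1 (hc w hw)
    rw [abs_of_nonpos h0] at hx
    show h (x + r • w) ≤ 0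
    linarith [h1.2]
  · refine ballMoment_eq_zero_of_const (c := 0) u fun w hw => indicator_of_notMem ?_ _
    have h1 := abs_le.1 (hc w hw)
    rw [abs_of_pos h0] at hx
    show ¬ h (x + r • w) ≤ 0
    linarith [h1.1]

/-- A proper affine subspace is null. This removes the `w` at which the limiting indicator is
discontinuous. -/
theorem ae_add_inner_ne_zero {p : E} (hp : p ≠ 0) (s : ℝ) : ∀ᵐ w : E, s + ⟪p, w⟫ ≠ 0 := by
  rw [ae_iff]
  simp only [not_not]
  rcases {w | s + ⟪p, w⟫ = 0}.eq_empty_or_nonempty with h0 | ⟨w₀, hw₀⟩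
  · rw [h0, measure_empty]
  · refine measure_mono_null (t := (AffineSubspace.mk' w₀ (ℝ ∙ p)ᗮ : Set E)) (fun w hw => ?_)
      (Measure.addHaar_affineSubspace _ _ fun htop => ?_)
    · simp only [mem_ofPred_eq] at hw hw₀
      rw [SetLike.mem_coe, AffineSubspace.mem_mk', vsub_eq_sub,
        Submodule.mem_orthogonal_singleton_iff_inner_right, inner_sub_right]
      linarith
    · have h1 : w₀ + p ∈ AffineSubspace.mk' w₀ (ℝ ∙ p)ᗮ := by
        rw [htop]
        exact AffineSubspace.mem_top _ _ _
      rw [AffineSubspace.mem_mk', vsub_eq_sub, add_sub_cancel_left,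
        Submodule.mem_orthogonal_singleton_iff_inner_right, inner_self_eq_zero] at h1
      exact hp h1

/-- The local regression signal of a jump, along points at signed distance proportional to the
radius from the jump surface. -/
theorem tendsto_ballMoment_stepFunction {h : E → ℝ} {U : Set E} (hU : IsOpen U)
    (hh : ContDiffOn ℝ 1 h U) (u : E) {y : E} (hy : y ∈ U) (hp : ∇ h y ≠ 0) {x : ℝ → E} {s : ℝ}
    (hx : Tendsto x (𝓝[>] 0) (𝓝 y)) (hxs : ∀ᶠ r in 𝓝[>] 0, h (x r) = r * s) :
    Tendsto (fun r => ballMoment (stepFunction h) u r (x r)) (𝓝[>] 0)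
      (𝓝 (-(⟪u, ∇ h y⟫ / ‖∇ h y‖ * jumpProfile (finrank ℝ E) (s / ‖∇ h y‖)))) := by
  rw [← setAverage_ball_inner_mul_indicator_add_inner u hp s, setAverage_eq]
  simp only [ballMoment, setAverage_eq]
  refine Tendsto.const_smul ?_ _
  have hpos : ∀ᶠ r : ℝ in 𝓝[>] 0, 0 < r := self_mem_nhdsWithin
  have hline : ∀ w : E, Tendsto (fun r => x r + r • w) (𝓝[>] 0) (𝓝 y) := fun w => by
    have h1 : Tendsto (fun r : ℝ => r • w) (𝓝[>] 0) (𝓝 0) := by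
      have h2 : Tendsto (fun r : ℝ => r • w) (𝓝 0) (𝓝 ((0 : ℝ) • w)) :=
        (continuous_id.smul continuous_const).tendsto 0
      rw [zero_smul] at h2
      exact h2.mono_left nhdsWithin_le_nhds
    simpa using hx.add h1
  have hmem : ∀ᶠ r in 𝓝[>] 0, ∀ w ∈ ball (0 : E) 1, x r + r • w ∈ U := by
    obtain ⟨ρ, hρ, hsub⟩ := Metric.isOpen_iff.1 hU y hy
    filter_upwards [hx.eventually (ball_mem_nhds y (half_pos hρ)), hpos,
      Ioo_mem_nhdsGT (half_pos hρ)] with r h1 h2 h3 w hw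
    refine hsub ?_
    have h4 := add_smul_mem_ball h2 (x r) hw
    rw [mem_ball] at *
    linarith [dist_triangle (x r + r • w) (x r) y, h3.2]
  refine tendsto_integral_filter_of_dominated_convergence (fun _ => ‖u‖) ?_ ?_
    (integrableOn_const measure_ball_lt_top.ne) ?_
  · filter_upwards [hmem] with r hr
    refine (by fun_prop : Measurable fun w => ⟪u, w⟫).aestronglyMeasurable.mul ?_
    have h1 : ContinuousOn (fun w => h (x r + r • w)) (ball (0 : E) 1) :=
      hh.continuousOn.comp (by fun_prop) fun w hw => hr w hw
    have h2 : Measurable ((Iic (0 : ℝ)).indicator fun _ => (1 : ℝ)) :=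
      measurable_const.indicator measurableSet_Iic
    exact (h2.comp_aemeasurable (h1.aemeasurable measurableSet_ball)).aestronglyMeasurable
  · refine Eventually.of_forall fun r => (ae_restrict_iff' measurableSet_ball).2
      (Eventually.of_forall fun w hw => ?_)
    rw [norm_mul]
    have h1 := abs_real_inner_le_norm u w
    have h2 : ‖w‖ ≤ 1 := (mem_ball_zero_iff.1 hw).le
    have h3 := mul_le_mul (h1.trans (mul_le_of_le_one_right (norm_nonneg _) h2))
      (abs_stepFunction_le h (x r + r • w)) (abs_nonneg _) (norm_nonneg _)
    rwa [mul_one] at h3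
  · refine ae_restrict_of_ae ?_
    filter_upwards [ae_add_inner_ne_zero hp s] with w hw
    refine Tendsto.const_mul _ ?_
    simp only [stepFunction_apply]
    -- Strict differentiability is used because both points `x r + r w` and `x r` move with `r`.
    have hstrict := (hh.hasStrictFDerivAt_innerSL_gradient hU hy).isLittleO
    have hpair : Tendsto (fun r => (x r + r • w, x r)) (𝓝[>] 0) (𝓝 (y, y)) :=
      (hline w).prodMk_nhds hx
    have hquot : Tendsto (fun r => r⁻¹ * h (x r + r • w)) (𝓝[>] 0) (𝓝 (s + ⟪∇ h y, w⟫)) := by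
      rw [Metric.tendsto_nhds]
      intro ε hε
      have hε' : 0 < ε / (‖w‖ + 1) := by positivity
      filter_upwards [hpair.eventually (hstrict.bound hε'), hxs, hpos] with r h1 h2 h3
      simp only [add_sub_cancel_left, h2, innerSL_apply_apply, inner_smul_right, norm_smul,
        Real.norm_of_nonneg h3.le] at h1
      have h4 : r⁻¹ * h (x r + r • w) - (s + ⟪∇ h y, w⟫) =
          r⁻¹ * (h (x r + r • w) - r * s - r * ⟪∇ h y, w⟫) := by
        field_simp
        ring
      rw [dist_eq_norm, h4, norm_mul, norm_inv, Real.norm_of_nonneg h3.le, inv_mul_lt_iff₀ h3]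
      refine h1.trans_lt ?_
      have h5 : ε / (‖w‖ + 1) * (r * ‖w‖) = r * ε * (‖w‖ / (‖w‖ + 1)) := by ring
      rw [h5]
      refine mul_lt_of_lt_one_right (by positivity) ?_
      rw [div_lt_one (by positivity)]
      linarith
    -- The indicator is eventually constant, since `h (x r + r w)` takes the sign of the nonzero
    -- number `s + ⟪∇ h y, w⟫`.
    refine tendsto_const_nhds.congr' ?_
    rcases lt_or_gt_of_ne hw with hneg | hpos'
    · filter_upwards [hquot.eventually_lt_const hneg, hpos] with r h1 h2
      have h3 : h (x r + r • w) < 0 := by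
        by_contra h4
        exact absurd h1 (not_lt.2 (mul_nonneg (inv_pos.2 h2).le (not_lt.1 h4)))
      rw [indicator_of_mem (by exact hneg.le), indicator_of_mem (by exact h3.le)]
    · filter_upwards [hquot.eventually_const_lt hpos', hpos] with r h1 h2
      have h3 : 0 < h (x r + r • w) := (pos_iff_pos_of_mul_pos h1).1 (inv_pos.2 h2)
      rw [indicator_of_notMem (by exact not_le.2 hpos'), indicator_of_notMem (by exact not_le.2 h3)]

end BallMoment

/-! ### Limits of integrated products of two moments. -/

section MomentProduct

open Module Set Metric
open scoped ENNReal NNReal RealInnerProductSpace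

variable {E : Type*} [NormedAddCommGroup E] [InnerProductSpace ℝ E] [FiniteDimensional ℝ E]
  [MeasurableSpace E] [BorelSpace E]

/-- The product of two local moments, weighted by `δ` on `X`. -/
noncomputable def momentProduct (X : Set E) (δ : E → ℝ) (F G : E → ℝ) (u v : E) (r : ℝ) (x : E) :
    ℝ :=
  X.indicator δ x * X.indicator (ballMoment F u r) x * X.indicator (ballMoment G v r) x

theorem momentProduct_comm (X : Set E) (δ : E → ℝ) (F G : E → ℝ) (u v : E) (r : ℝ) :
    momentProduct X δ F G u v r = momentProduct X δ G F v u r := by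
  ext x
  simp only [momentProduct]
  ring

theorem mem_of_momentProduct_ne_zero {X : Set E} {δ : E → ℝ} {F G : E → ℝ} {u v : E} {r : ℝ}
    {x : E} (h : momentProduct X δ F G u v r x ≠ 0) : x ∈ X :=
  mem_of_indicator_ne_zero (right_ne_zero_of_mul h)

theorem abs_indicator_le_of_forall_mem {E : Type*} {X : Set E} {f : E → ℝ} {C : ℝ} (hC0 : 0 ≤ C)
    (hC : ∀ x ∈ X, |f x| ≤ C) (x : E) : |X.indicator f x| ≤ C := by
  by_cases hx : x ∈ X
  · rw [indicator_of_mem hx]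
    exact hC x hx
  · rwa [indicator_of_notMem hx, abs_zero]

-- At a frontier point the extension by zero is continuous as soon as `δ` vanishes there. Thus the
-- boundary hypothesis gives continuity at almost every point of a jump surface.
omit [InnerProductSpace ℝ E] [FiniteDimensional ℝ E] [MeasurableSpace E] [BorelSpace E] in
theorem ContinuousOn.continuousAt_indicator_of_frontier {X : Set E} {δ : E → ℝ}
    (hδ : ContinuousOn δ X) {y : E} (hy : y ∈ X) (h : y ∈ frontier X → δ y = 0) :
    ContinuousAt (X.indicator δ) y := by
  by_cases hf : y ∈ frontier X
  · have h0 := h hf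
    have h1 : Tendsto δ (𝓝[X] y) (𝓝 0) := by
      rw [← h0]
      exact hδ y hy
    rw [ContinuousAt, indicator_of_mem hy, h0]
    rw [Metric.tendsto_nhds] at h1 ⊢
    intro ε hε
    filter_upwards [eventually_nhdsWithin_iff.1 (h1 ε hε)] with x hx
    by_cases hxX : x ∈ X
    · rw [indicator_of_mem hxX]
      exact hx hxX
    · rw [indicator_of_notMem hxX, dist_self]
      exact hε
  · have hint : X ∈ 𝓝 y := by
      rw [mem_interior_iff_mem_nhds.symm]
      by_contra h2
      exact hf ⟨subset_closure hy, h2⟩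
    refine (hδ.continuousAt hint).congr ?_
    filter_upwards [hint] with x hx
    rw [indicator_of_mem hx]

variable {X U K : Set E} {δ : E → ℝ}

theorem eventually_measurable_momentProduct (hX : IsCompact X) (hδ : ContinuousOn δ X)
    (hK : ∀ᶠ r in 𝓝[>] (0 : ℝ), ∀ x ∈ X, ball x r ⊆ K) {F G : E → ℝ}
    (hF : Measurable (K.indicator F)) (hG : Measurable (K.indicator G)) (u v : E) :
    ∀ᶠ r in 𝓝[>] 0, Measurable (momentProduct X δ F G u v r) := by
  filter_upwards [hK, self_mem_nhdsWithin] with r hr hr0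
  have hm : ∀ x ∈ X, ∀ w ∈ ball (0 : E) 1, x + r • w ∈ K := fun x hx w hw =>
    hr x hx (add_smul_mem_ball hr0 x hw)
  exact ((hδ.measurable_indicator hX.measurableSet).mul
    (measurable_indicator_ballMoment hX.measurableSet hF u hm)).mul
    (measurable_indicator_ballMoment hX.measurableSet hG v hm)

theorem eventually_abs_indicator_ballMoment_le
    (hK : ∀ᶠ r in 𝓝[>] (0 : ℝ), ∀ x ∈ X, ball x r ⊆ K) {F : E → ℝ} {C : ℝ} (hC0 : 0 ≤ C)
    (hC : ∀ x ∈ K, |F x| ≤ C) (u : E) :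
    ∀ᶠ r in 𝓝[>] 0, ∀ x, |X.indicator (ballMoment F u r) x| ≤ ‖u‖ * C := by
  filter_upwards [hK, self_mem_nhdsWithin] with r hr hr0
  exact abs_indicator_le_of_forall_mem (by positivity) fun x hx =>
    abs_ballMoment_le u fun w hw => hC _ (hr x hx (add_smul_mem_ball hr0 x hw))

theorem exists_abs_momentProduct_le (hX : IsCompact X) (hδ : ContinuousOn δ X)
    (hK : ∀ᶠ r in 𝓝[>] (0 : ℝ), ∀ x ∈ X, ball x r ⊆ K) {F G : E → ℝ} {C D : ℝ} (hC0 : 0 ≤ C)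
    (hD0 : 0 ≤ D) (hC : ∀ x ∈ K, |F x| ≤ C) (hD : ∀ x ∈ K, |G x| ≤ D) (u v : E) :
    ∃ M, ∀ᶠ r in 𝓝[>] 0, ∀ x, |momentProduct X δ F G u v r x| ≤ M := by
  obtain ⟨B, hB⟩ := hX.exists_bound_of_continuousOn hδ
  refine ⟨max B 0 * (‖u‖ * C) * (‖v‖ * D), ?_⟩
  filter_upwards [eventually_abs_indicator_ballMoment_le hK hC0 hC u,
    eventually_abs_indicator_ballMoment_le hK hD0 hD v] with r h1 h2 x
  have h0 := abs_indicator_le_of_forall_mem (le_max_right B 0)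
    (fun x hx => (hB x hx).trans (le_max_left _ _)) x
  rw [momentProduct, abs_mul, abs_mul]
  gcongr
  · exact h1 x
  · exact h2 x

theorem eventually_integrable_momentProduct (hX : IsCompact X) (hδ : ContinuousOn δ X)
    (hK : ∀ᶠ r in 𝓝[>] (0 : ℝ), ∀ x ∈ X, ball x r ⊆ K) {F G : E → ℝ} {C D : ℝ} (hC0 : 0 ≤ C)
    (hD0 : 0 ≤ D) (hF : Measurable (K.indicator F)) (hG : Measurable (K.indicator G))
    (hC : ∀ x ∈ K, |F x| ≤ C) (hD : ∀ x ∈ K, |G x| ≤ D) (u v : E) :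
    ∀ᶠ r in 𝓝[>] 0, Integrable (momentProduct X δ F G u v r) := by
  obtain ⟨M, hM⟩ := exists_abs_momentProduct_le hX hδ hK hC0 hD0 hC hD u v
  filter_upwards [eventually_measurable_momentProduct hX hδ hK hF hG u v, hM] with r h1 h2
  rw [← integrableOn_iff_integrable_of_support_subset (s := X) fun x hx =>
    mem_of_momentProduct_ne_zero hx]
  exact Measure.integrableOn_of_bounded hX.measure_lt_top.ne h1.aestronglyMeasurable
    (Eventually.of_forall h2)

theorem exists_momentProduct_stepFunction_support (hX : IsCompact X) (hU : IsOpen U)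
    (hXU : X ⊆ U) {h : E → ℝ} (hh : ContDiffOn ℝ 1 h U) (δ G : E → ℝ) (u v : E) :
    ∃ L, ∀ᶠ r in 𝓝[>] 0, ∀ x, momentProduct X δ (stepFunction h) G u v r x ≠ 0 →
      x ∈ X ∧ |h x| ≤ L * r := by
  obtain ⟨L, hL⟩ := exists_abs_sub_le_mul hX hU hXU hh
  refine ⟨L, ?_⟩
  filter_upwards [hL] with r hr x hx
  have hxX := mem_of_momentProduct_ne_zero hx
  refine ⟨hxX, ?_⟩
  by_contra hlt
  refine right_ne_zero_of_mul (left_ne_zero_of_mul hx) ?_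
  rw [indicator_of_mem hxX]
  exact ballMoment_stepFunction_eq_zero u (hr x hxX) (not_le.1 hlt)

/-- Away from its own zero set a jump has eventually zero moment; this kills the products of
distinct jumps. -/
theorem tendsto_indicator_ballMoment_stepFunction_zero (hX : IsCompact X) (hU : IsOpen U)
    (hXU : X ⊆ U) {h : E → ℝ} (hh : ContDiffOn ℝ 1 h U) (u : E) {y : E} (hy : y ∈ U)
    (hy0 : h y ≠ 0) {x : ℝ → E} (hx : Tendsto x (𝓝[>] 0) (𝓝 y)) :
    Tendsto (fun r => X.indicator (ballMoment (stepFunction h) u r) (x r)) (𝓝[>] 0) (𝓝 0) := by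
  obtain ⟨L, hL⟩ := exists_abs_sub_le_mul hX hU hXU hh
  have h1 : Tendsto (fun r : ℝ => L * r) (𝓝[>] 0) (𝓝 0) := by
    have h1 : Tendsto (fun r : ℝ => L * r) (𝓝 0) (𝓝 (L * 0)) :=
      (continuous_const.mul continuous_id).tendsto 0
    rw [mul_zero] at h1
    exact h1.mono_left nhdsWithin_le_nhds
  have h2 : Tendsto (fun r => |h (x r)|) (𝓝[>] 0) (𝓝 |h y|) :=
    ((hh.continuousOn.continuousAt (hU.mem_nhds hy)).tendsto.comp hx).abs
  refine tendsto_const_nhds.congr' ?_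
  filter_upwards [hL, h1.eventually_lt h2 (abs_pos.2 hy0)] with r h3 h4
  by_cases hxX : x r ∈ X
  · rw [indicator_of_mem hxX, ballMoment_stepFunction_eq_zero u (h3 _ hxX) h4]
  · rw [indicator_of_notMem hxX]

theorem exists_abs_indicator_ballMoment_le_mul (hX : IsCompact X) (hU : IsOpen U)
    (hXU : X ⊆ U) {g : E → ℝ} (hg : ContDiffOn ℝ 1 g U) (u : E) :
    ∃ L, 0 ≤ L ∧
      ∀ᶠ r in 𝓝[>] (0 : ℝ), ∀ x, |X.indicator (ballMoment g u r) x| ≤ L * r := by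
  obtain ⟨K, hKU, hKc, -, hK⟩ := exists_isCompact_forall_add_mem hX hU hXU
  obtain ⟨C, hC⟩ := hKc.exists_bound_of_continuousOn (hg.continuousOn.mono hKU)
  obtain ⟨L, hL⟩ := exists_abs_sub_le_mul hX hU hXU hg
  refine ⟨‖u‖ * max L 0, by positivity, ?_⟩
  filter_upwards [hK, hL, self_mem_nhdsWithin] with r h1 h2 (hr0 : 0 < r)
  refine abs_indicator_le_of_forall_mem (by positivity) fun x hx => ?_
  rw [mul_assoc]
  refine abs_ballMoment_le_of_abs_sub_le u (integrableOn_ball_inner_mul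
    ((hg.continuousOn.mono hKU).measurable_indicator hKc.measurableSet) hC u fun w hw =>
      h1 x hx (add_smul_mem_ball hr0 x hw)) fun w hw => ?_
  exact (h2 x hx w hw).trans (mul_le_mul_of_nonneg_right (le_max_left _ _) hr0.le)

/-- The contribution of one regular jump to the limit. -/
theorem tendsto_integral_momentProduct_stepFunction_self (hX : IsCompact X) (hU : IsOpen U)
    (hXU : X ⊆ U) {h : E → ℝ} (hh : ContDiffOn ℝ 1 h U)
    (hgrad : ∀ x ∈ X, h x = 0 → ∇ h x ≠ 0) (hδ : ContinuousOn δ X)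
    (hbd : μHE[finrank ℝ E - 1] {x ∈ frontier X | h x = 0 ∧ δ x ≠ 0} = 0) (u v : E)
    (hint : IntegrableOn (fun y => ⟪u, ∇ h y⟫ * ⟪v, ∇ h y⟫ / ‖∇ h y‖ ^ 2 * δ y)
      {x ∈ X | h x = 0} μHE[finrank ℝ E - 1]) :
    Tendsto (fun r => r⁻¹ * ∫ x, momentProduct X δ (stepFunction h) (stepFunction h) u v r x)
      (𝓝[>] 0) (𝓝 ((sliceIntegral (finrank ℝ E + 1) /
        ((finrank ℝ E + 1) * sliceIntegral (((finrank ℝ E : ℝ) - 1) / 2)) ^ 2) *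
        ∫ y in {x ∈ X | h x = 0}, ⟪u, ∇ h y⟫ * ⟪v, ∇ h y⟫ / ‖∇ h y‖ ^ 2 * δ y
          ∂μHE[finrank ℝ E - 1])) := by
  set κ := sliceIntegral (finrank ℝ E + 1) /
        ((finrank ℝ E + 1) * sliceIntegral (((finrank ℝ E : ℝ) - 1) / 2)) ^ 2 with hκ
  obtain ⟨K, hKU, hKc, -, hK⟩ := exists_isCompact_forall_add_mem hX hU hXU
  have hF := measurable_indicator_stepFunction hKc (hh.continuousOn.mono hKU)
  obtain ⟨M, hM⟩ := exists_abs_momentProduct_le hX hδ hK zero_le_one zero_le_one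
    (fun x _ => abs_stepFunction_le h x) (fun x _ => abs_stepFunction_le h x) u v
  obtain ⟨L, hL⟩ := exists_momentProduct_stepFunction_support hX hU hXU hh δ (stepFunction h) u v
  have hZm : MeasurableSet {x ∈ X | h x = 0} :=
    (hX.levelSet (hh.continuousOn.mono hXU)).measurableSet
  set F₀ : E → ℝ → ℝ := fun y s => δ y *
    (-(⟪u, ∇ h y⟫ / ‖∇ h y‖ * jumpProfile (finrank ℝ E) (s / ‖∇ h y‖))) *
    (-(⟪v, ∇ h y⟫ / ‖∇ h y‖ * jumpProfile (finrank ℝ E) (s / ‖∇ h y‖))) with hF₀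
  -- The two minus signs cancel, and `‖∇h‖⁻¹` cancels the factor from rescaling the profile.
  have hval : ∀ y ∈ {x ∈ X | h x = 0}, ‖∇ h y‖⁻¹ * ∫ s, F₀ y s =
      κ * (⟪u, ∇ h y⟫ * ⟪v, ∇ h y⟫ / ‖∇ h y‖ ^ 2 * δ y) := by
    intro y hy
    have hp : 0 < ‖∇ h y‖ := norm_pos_iff.2 (hgrad y hy.1 hy.2)
    have h1 : ∀ s, F₀ y s = ⟪u, ∇ h y⟫ * ⟪v, ∇ h y⟫ / ‖∇ h y‖ ^ 2 * δ y *
        jumpProfile (finrank ℝ E) (s / ‖∇ h y‖) ^ 2 := fun s => by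
      simp only [hF₀]
      field_simp
    simp_rw [h1]
    rw [integral_const_mul, integral_jumpProfile_sq _ hp, ← hκ]
    field_simp
  have hT := tendsto_integral_levelSet hX hU hXU hh hgrad
    (eventually_measurable_momentProduct hX hδ hK hF hF u v) hM hL (F₀ := F₀) ?_ ?_
  · rw [setIntegral_congr_fun hZm hval, integral_const_mul] at hT
    exact hT
  · rw [ae_restrict_iff' hZm]
    have hae : ∀ᵐ y ∂μHE[finrank ℝ E - 1], y ∉ {x ∈ frontier X | h x = 0 ∧ δ x ≠ 0} :=
      measure_eq_zero_iff_ae_notMem.1 hbd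
    filter_upwards [hae] with y hy hyZ
    refine Eventually.of_forall fun s x hx hxs => ?_
    have hδc : ContinuousAt (X.indicator δ) y :=
      hδ.continuousAt_indicator_of_frontier hyZ.1 fun hf => by
        by_contra h0
        exact hy ⟨hf, hyZ.2, h0⟩
    have hδx := hδc.tendsto.comp hx
    rw [indicator_of_mem hyZ.1] at hδx
    have hp := hgrad y hyZ.1 hyZ.2
    have h1 := (hδx.mul (tendsto_ballMoment_stepFunction hU hh u (hXU hyZ.1) hp hx hxs)).mul
      (tendsto_ballMoment_stepFunction hU hh v (hXU hyZ.1) hp hx hxs)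
    refine h1.congr fun r => ?_
    simp only [momentProduct, Function.comp_apply]
    -- The curve may leave `X`, but there the extended density already makes both products zero.
    by_cases hxX : x r ∈ X
    · simp only [indicator_of_mem hxX]
    · simp only [indicator_of_notMem hxX, zero_mul]
  · exact IntegrableOn.congr_fun (hint.const_mul κ) (fun y hy => (hval y hy).symm) hZm

/-- The contributions of a jump paired with a function whose local moments vanish on the jump
surface. -/
theorem tendsto_integral_momentProduct_stepFunction_zero (hX : IsCompact X) (hU : IsOpen U)
    (hXU : X ⊆ U) {h : E → ℝ} (hh : ContDiffOn ℝ 1 h U)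
    (hgrad : ∀ x ∈ X, h x = 0 → ∇ h x ≠ 0) (hδ : ContinuousOn δ X)
    (hKc : IsCompact K) (hKU : K ⊆ U) (hK : ∀ᶠ r in 𝓝[>] (0 : ℝ), ∀ x ∈ X, ball x r ⊆ K)
    {G : E → ℝ} {D : ℝ} (hD0 : 0 ≤ D) (hG : Measurable (K.indicator G))
    (hD : ∀ x ∈ K, |G x| ≤ D) (u v : E)
    (hlim : ∀ᵐ y ∂μHE[finrank ℝ E - 1].restrict {x ∈ X | h x = 0}, δ y = 0 ∨
      ∀ x : ℝ → E, Tendsto x (𝓝[>] 0) (𝓝 y) →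
        Tendsto (fun r => X.indicator (ballMoment G v r) (x r)) (𝓝[>] 0) (𝓝 0)) :
    Tendsto (fun r => r⁻¹ * ∫ x, momentProduct X δ (stepFunction h) G u v r x)
      (𝓝[>] 0) (𝓝 0) := by
  have hF := measurable_indicator_stepFunction hKc (hh.continuousOn.mono hKU)
  obtain ⟨M, hM⟩ := exists_abs_momentProduct_le hX hδ hK zero_le_one hD0
    (fun x _ => abs_stepFunction_le h x) hD u v
  obtain ⟨L, hL⟩ := exists_momentProduct_stepFunction_support hX hU hXU hh δ G u v
  have hZm : MeasurableSet {x ∈ X | h x = 0} :=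
    (hX.levelSet (hh.continuousOn.mono hXU)).measurableSet
  obtain ⟨B, hB⟩ := hX.exists_bound_of_continuousOn hδ
  have hb1 := eventually_abs_indicator_ballMoment_le (X := X) hK zero_le_one
    (fun x _ => abs_stepFunction_le h x) u
  have hb2 := eventually_abs_indicator_ballMoment_le (X := X) hK hD0 hD v
  have hT := tendsto_integral_levelSet hX hU hXU hh hgrad
    (eventually_measurable_momentProduct hX hδ hK hF hG u v) hM hL (F₀ := fun _ _ => 0) ?_ ?_
  · simpa using hT
  · filter_upwards [hlim, ae_restrict_mem hZm] with y hy hyZ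
    refine Eventually.of_forall fun s x hx _ => ?_
    -- One factor tends to zero, either the density or the second moment, and the other two stay
    -- bounded.
    rcases hy with hy | hy
    · have hδc := (hδ.continuousAt_indicator_of_frontier hyZ.1 fun _ => hy).tendsto.comp hx
      rw [indicator_of_mem hyZ.1, hy] at hδc
      have h1 : Tendsto (fun r => X.indicator δ (x r) *
          (X.indicator (ballMoment (stepFunction h) u r) (x r) *
            X.indicator (ballMoment G v r) (x r))) (𝓝[>] 0) (𝓝 0) := by
        refine hδc.zero_mul_isBoundedUnder_le ⟨‖u‖ * 1 * (‖v‖ * D), ?_⟩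
        rw [eventually_map]
        filter_upwards [hb1, hb2] with r h2 h3
        simp only [Function.comp_apply, norm_mul]
        exact mul_le_mul (h2 _) (h3 _) (abs_nonneg _) (by positivity)
      exact h1.congr fun r => by simp only [momentProduct]; ring
    · have h1 : Tendsto (fun r => X.indicator (ballMoment G v r) (x r) *
          (X.indicator δ (x r) * X.indicator (ballMoment (stepFunction h) u r) (x r)))
          (𝓝[>] 0) (𝓝 0) := by
        refine (hy x hx).zero_mul_isBoundedUnder_le ⟨max B 0 * (‖u‖ * 1), ?_⟩
        rw [eventually_map]
        filter_upwards [hb1] with r h2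
        simp only [Function.comp_apply, norm_mul]
        exact mul_le_mul (abs_indicator_le_of_forall_mem (le_max_right B 0)
          (fun x hx => (hB x hx).trans (le_max_left _ _)) _) (h2 _) (abs_nonneg _) (by positivity)
      exact h1.congr fun r => by simp only [momentProduct]; ring
  · simp [IntegrableOn]

/-- Both moments are `O(r)`, so even after division by `r` the integral is `O(r)`. -/
theorem tendsto_integral_momentProduct_zero (hX : IsCompact X) (hU : IsOpen U)
    (hXU : X ⊆ U) {g : E → ℝ} (hg : ContDiffOn ℝ 1 g U) (hδ : ContinuousOn δ X) (u v : E) :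
    Tendsto (fun r => r⁻¹ * ∫ x, momentProduct X δ g g u v r x) (𝓝[>] 0) (𝓝 0) := by
  obtain ⟨B, hB⟩ := hX.exists_bound_of_continuousOn hδ
  obtain ⟨L, hL0, hL⟩ := exists_abs_indicator_ballMoment_le_mul hX hU hXU hg u
  obtain ⟨L', hL0', hL'⟩ := exists_abs_indicator_ballMoment_le_mul hX hU hXU hg v
  refine squeeze_zero_norm' (a := fun r => max B 0 * L * L' * volume.real X * r) ?_ ?_
  · filter_upwards [hL, hL', self_mem_nhdsWithin] with r h1 h2 (hr0 : 0 < r)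
    have h3 : ‖∫ x in X, momentProduct X δ g g u v r x‖ ≤
        max B 0 * (L * r) * (L' * r) * volume.real X := by
      refine norm_setIntegral_le_of_norm_le_const hX.measure_lt_top fun x hx => ?_
      rw [momentProduct, norm_mul, norm_mul]
      have h0 := abs_indicator_le_of_forall_mem (le_max_right B 0)
        (fun x hx => (hB x hx).trans (le_max_left _ _)) x
      refine mul_le_mul (mul_le_mul h0 (h1 x) (abs_nonneg _) (le_max_right _ _)) (h2 x)
        (abs_nonneg _) (by positivity)
    rw [setIntegral_eq_integral_of_forall_compl_eq_zero fun x hx => by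
      by_contra h4
      exact hx (mem_of_momentProduct_ne_zero h4)] at h3
    rw [norm_mul, norm_inv, Real.norm_of_nonneg hr0.le, inv_mul_le_iff₀ hr0]
    refine h3.trans (le_of_eq ?_)
    ring
  · have h1 : Tendsto (fun r : ℝ => max B 0 * L * L' * volume.real X * r) (𝓝 0)
        (𝓝 (max B 0 * L * L' * volume.real X * 0)) :=
      (continuous_const.mul continuous_id).tendsto 0
    rw [mul_zero] at h1
    exact h1.mono_left nhdsWithin_le_nhds

end MomentProduct

/-! ### All pairs of summands of the piecewise smooth function. -/

section JumpPieces

open Module Set Metric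
open scoped ENNReal NNReal RealInnerProductSpace

variable {E : Type*} [NormedAddCommGroup E] [InnerProductSpace ℝ E] [FiniteDimensional ℝ E]
  [MeasurableSpace E] [BorelSpace E] {ι : Type*}

/-- The summands of a piecewise smooth function: the unit jumps, and the smooth part. -/
noncomputable def jumpPiece {E : Type*} (h : ι → E → ℝ) (g : E → ℝ) (o : Option ι) : E → ℝ :=
  o.elim g fun j => stepFunction (h j)

/-- The coefficients of the summands of a piecewise smooth function. -/
def jumpCoeff (c : ι → ℝ) (o : Option ι) : ℝ :=
  o.elim 1 c

variable {X U K : Set E} {δ : E → ℝ} {h : ι → E → ℝ} {g : E → ℝ}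

omit [InnerProductSpace ℝ E] [FiniteDimensional ℝ E] in
theorem measurable_indicator_jumpPiece (hK : IsCompact K) (hh : ∀ j, ContinuousOn (h j) K)
    (hg : ContinuousOn g K) (o : Option ι) : Measurable (K.indicator (jumpPiece h g o)) := by
  rcases o with _ | j
  · exact hg.measurable_indicator hK.measurableSet
  · exact measurable_indicator_stepFunction hK (hh j)

omit [InnerProductSpace ℝ E] [FiniteDimensional ℝ E] [MeasurableSpace E] [BorelSpace E] in
theorem exists_abs_jumpPiece_le (hK : IsCompact K) (h : ι → E → ℝ) (hg : ContinuousOn g K) :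
    ∃ C, 0 ≤ C ∧ ∀ o, ∀ x ∈ K, |jumpPiece h g o x| ≤ C := by
  obtain ⟨C, hC⟩ := hK.exists_bound_of_continuousOn hg
  refine ⟨max C 1, by positivity, ?_⟩
  rintro (_ | j) x hx
  · exact (hC x hx).trans (le_max_left _ _)
  · exact (abs_stepFunction_le (h j) x).trans (le_max_right _ _)

/-- The integrand is continuous on a compact level set of finite surface measure. -/
theorem integrableOn_normal_mul_normal {f : E → ℝ} (hX : IsCompact X) (hU : IsOpen U)
    (hXU : X ⊆ U) (hf : ContDiffOn ℝ 1 f U) (hgrad : ∀ x ∈ X, f x = 0 → ∇ f x ≠ 0)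
    (hδ : ContinuousOn δ X) (u v : E) :
    IntegrableOn (fun y => ⟪u, ∇ f y⟫ * ⟪v, ∇ f y⟫ / ‖∇ f y‖ ^ 2 * δ y)
      {x ∈ X | f x = 0} μHE[finrank ℝ E - 1] := by
  have hZ : IsCompact {x ∈ X | f x = 0} := hX.levelSet (hf.continuousOn.mono hXU)
  have hsub : {x ∈ X | f x = 0} ⊆ X := fun x hx => hx.1
  have hp : ContinuousOn (∇ f) {x ∈ X | f x = 0} :=
    (hf.continuousOn_gradient hU).mono (hsub.trans hXU)
  have hc : ContinuousOn (fun y => ⟪u, ∇ f y⟫ * ⟪v, ∇ f y⟫ / ‖∇ f y‖ ^ 2 * δ y)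
      {x ∈ X | f x = 0} :=
    (((continuousOn_const.inner hp).mul (continuousOn_const.inner hp)).div (hp.norm.pow 2)
      fun x hx => pow_ne_zero 2 (norm_ne_zero_iff.2 (hgrad x hx.1 hx.2))).mul (hδ.mono hsub)
  obtain ⟨C, hC⟩ := hZ.exists_bound_of_continuousOn hc
  exact IntegrableOn.of_bound (euclideanHausdorffMeasure_levelSet_lt_top hX hU hXU hf hgrad)
    (hc.aestronglyMeasurable hZ.measurableSet) C ((ae_restrict_mem hZ.measurableSet).mono hC)

/-- The limit of the rescaled integral of the product of the local moments of two summands. -/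
noncomputable def pieceLimit [DecidableEq ι] (X : Set E) (δ : E → ℝ) (h : ι → E → ℝ) (u v : E)
    (o o' : Option ι) : ℝ :=
  if o = o' then o.elim 0 fun j => (sliceIntegral (finrank ℝ E + 1) /
    ((finrank ℝ E + 1) * sliceIntegral (((finrank ℝ E : ℝ) - 1) / 2)) ^ 2) *
      ∫ y in {x ∈ X | h j x = 0}, ⟪u, ∇ (h j) y⟫ * ⟪v, ∇ (h j) y⟫ / ‖∇ (h j) y‖ ^ 2 * δ y
        ∂μHE[finrank ℝ E - 1]
  else 0

/-- Only a jump paired with itself survives. Pairs involving `g` vanish because its moment is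
`O(r)`; at almost every point where distinct jump surfaces meet, `δ` is zero. -/
theorem tendsto_integral_momentProduct_jumpPiece [DecidableEq ι] (hX : IsCompact X)
    (hU : IsOpen U) (hXU : X ⊆ U) (hh : ∀ j, ContDiffOn ℝ 1 (h j) U) (hg : ContDiffOn ℝ 1 g U)
    (hgrad : ∀ j, ∀ x ∈ X, h j x = 0 → ∇ (h j) x ≠ 0) (hδ : ContinuousOn δ X)
    (hoverlap : ∀ j k, j ≠ k →
      μHE[finrank ℝ E - 1] {x ∈ X | h j x = 0 ∧ h k x = 0 ∧ δ x ≠ 0} = 0)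
    (hboundary : ∀ j, μHE[finrank ℝ E - 1] {x ∈ frontier X | h j x = 0 ∧ δ x ≠ 0} = 0)
    (u v : E) (o o' : Option ι) :
    Tendsto (fun r => r⁻¹ * ∫ x, momentProduct X δ (jumpPiece h g o) (jumpPiece h g o') u v r x)
      (𝓝[>] 0) (𝓝 (pieceLimit X δ h u v o o')) := by
  obtain ⟨K, hKU, hKc, -, hK⟩ := exists_isCompact_forall_add_mem hX hU hXU
  have hm := measurable_indicator_jumpPiece hKc (fun j => (hh j).continuousOn.mono hKU)
    (hg.continuousOn.mono hKU)
  obtain ⟨C, hC0, hC⟩ := exists_abs_jumpPiece_le hKc h (hg.continuousOn.mono hKU)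
  have hjg : ∀ (j : ι) (u v : E), Tendsto
      (fun r => r⁻¹ * ∫ x, momentProduct X δ (stepFunction (h j)) g u v r x) (𝓝[>] 0) (𝓝 0) := by
    intro j u v
    refine tendsto_integral_momentProduct_stepFunction_zero hX hU hXU (hh j) (hgrad j) hδ hKc hKU
      hK hC0 (hm none) (hC none) u v (Eventually.of_forall fun y => Or.inr fun x _ => ?_)
    obtain ⟨L, -, hL⟩ := exists_abs_indicator_ballMoment_le_mul hX hU hXU hg v
    have h1 : Tendsto (fun r : ℝ => L * r) (𝓝 0) (𝓝 (L * 0)) :=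
      (continuous_const.mul continuous_id).tendsto 0
    rw [mul_zero] at h1
    exact squeeze_zero_norm' (hL.mono fun r hr => hr (x r)) (h1.mono_left nhdsWithin_le_nhds)
  rcases o with _ | j <;> rcases o' with _ | k
  · rw [pieceLimit, if_pos rfl]
    exact tendsto_integral_momentProduct_zero hX hU hXU hg hδ u v
  · rw [pieceLimit, if_neg (by simp)]
    simp_rw [momentProduct_comm X δ (jumpPiece h g none)]
    exact hjg k v u
  · rw [pieceLimit, if_neg (by simp)]
    exact hjg j u v
  · by_cases hjk : j = k
    · subst hjk
      rw [pieceLimit, if_pos rfl]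
      exact tendsto_integral_momentProduct_stepFunction_self hX hU hXU (hh j) (hgrad j) hδ
        (hboundary j) u v (integrableOn_normal_mul_normal hX hU hXU (hh j) (hgrad j) hδ u v)
    · rw [pieceLimit, if_neg (by simpa using hjk)]
      refine tendsto_integral_momentProduct_stepFunction_zero hX hU hXU (hh j) (hgrad j) hδ hKc
        hKU hK hC0 (hm (some k)) (hC (some k)) u v ?_
      have hZm : MeasurableSet {x ∈ X | h j x = 0} :=
        (hX.levelSet ((hh j).continuousOn.mono hXU)).measurableSet
      rw [ae_restrict_iff' hZm]
      have hae : ∀ᵐ y ∂μHE[finrank ℝ E - 1], y ∉ {x ∈ X | h j x = 0 ∧ h k x = 0 ∧ δ x ≠ 0} :=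
        measure_eq_zero_iff_ae_notMem.1 (hoverlap j k hjk)
      filter_upwards [hae] with y hy hyZ
      by_cases h0 : δ y = 0
      · exact Or.inl h0
      · exact Or.inr fun x hx => tendsto_indicator_ballMoment_stepFunction_zero hX hU hXU (hh k) v
          (hXU hyZ.1) (fun hk => hy ⟨hyZ.1, hyZ.2, hk, h0⟩) hx

theorem sum_sum_mul_pieceLimit [Fintype ι] [DecidableEq ι] (X : Set E) (δ : E → ℝ)
    (h : ι → E → ℝ) (u v : E) (c : ι → ℝ) :
    ∑ o, ∑ o', jumpCoeff c o * jumpCoeff c o' * pieceLimit X δ h u v o o' =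
      (sliceIntegral (finrank ℝ E + 1) /
        ((finrank ℝ E + 1) * sliceIntegral (((finrank ℝ E : ℝ) - 1) / 2)) ^ 2) *
      ∑ j, c j ^ 2 * ∫ y in {x ∈ X | h j x = 0},
        ⟪u, ∇ (h j) y⟫ * ⟪v, ∇ (h j) y⟫ / ‖∇ (h j) y‖ ^ 2 * δ y ∂μHE[finrank ℝ E - 1] := by
  simp only [pieceLimit, mul_ite, mul_zero, Finset.sum_ite_eq, Finset.mem_univ, if_true,
    Fintype.sum_option, Option.elim, jumpCoeff, zero_add]
  rw [Finset.mul_sum]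
  exact Finset.sum_congr rfl fun j _ => by ring

theorem sum_jumpCoeff_mul_jumpPiece {E : Type*} [Fintype ι] (c : ι → ℝ) (h : ι → E → ℝ)
    (g : E → ℝ) (x : E) :
    ∑ o, jumpCoeff c o * jumpPiece h g o x = ∑ j, c j * stepFunction (h j) x + g x := by
  simp only [Fintype.sum_option, Option.elim, jumpCoeff, jumpPiece, one_mul]
  exact add_comm _ _

end JumpPieces

/-! ### Regression coefficients as unit-ball moments, and the assembly. -/

section Euclidean

open Module Set Metric
open scoped ENNReal NNReal RealInnerProductSpace

theorem setAverage_ball_comp_smul {E : Type*} [NormedAddCommGroup E] [InnerProductSpace ℝ E]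
    [FiniteDimensional ℝ E] [MeasurableSpace E] [BorelSpace E] (G : E → ℝ) {r : ℝ} (hr : 0 < r) :
    ⨍ z in ball (0 : E) r, G z = ⨍ w in ball (0 : E) 1, G (r • w) := by
  rw [setAverage_eq, setAverage_eq, Measure.setIntegral_comp_smul_of_pos _ _ _ hr,
    smul_unitBall_of_pos hr, measureReal_def, Measure.addHaar_ball_of_pos _ _ hr,
    ENNReal.toReal_mul, ENNReal.toReal_ofReal (by positivity), smul_smul, mul_inv, mul_comm,
    measureReal_def]

variable {P : ℕ}

theorem ballSecondMoment_eq (P : ℕ) {r : ℝ} (hr : 0 < r) :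
    ballSecondMoment P r = (r ^ 2 / ((P : ℝ) + 2)) • (1 : Matrix (Fin P) (Fin P) ℝ) := by
  ext i k
  have h1 : ∀ w : EuclideanSpace ℝ (Fin P), (r • w) i * (r • w) k = r ^ 2 *
      (⟪EuclideanSpace.single i (1 : ℝ), w⟫ * ⟪EuclideanSpace.single k (1 : ℝ), w⟫) := fun w => by
    simp only [EuclideanSpace.inner_single_left, PiLp.smul_apply, smul_eq_mul, map_one, one_mul]
    ring
  rw [ballSecondMoment, Matrix.of_apply, setAverage_ball_comp_smul _ hr]
  simp_rw [h1]
  have h2 := setAverage_ball_inner_mul_inner (EuclideanSpace.single i (1 : ℝ))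
    (n := EuclideanSpace.single k (1 : ℝ)) (by simp)
  rw [setAverage_eq] at h2 ⊢
  rw [integral_const_mul, smul_eq_mul, mul_left_comm, ← smul_eq_mul (_⁻¹), h2,
    finrank_euclideanSpace, Fintype.card_fin]
  simp only [EuclideanSpace.inner_single_left, map_one, one_mul, Matrix.smul_apply,
    Matrix.one_apply, smul_eq_mul, PiLp.single_apply]
  split_ifs <;> ring

/-- The inverse second moment gives `(P + 2) / r²`, and `z = r w` returns one power of `r`. -/
theorem localRegressionCoeff_eq (f : EuclideanSpace ℝ (Fin P) → ℝ) {r : ℝ} (hr : 0 < r)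
    (x : EuclideanSpace ℝ (Fin P)) (i : Fin P) :
    localRegressionCoeff f r x i =
      ((P : ℝ) + 2) / r * ballMoment f (EuclideanSpace.single i 1) r x := by
  have h0 : r ^ 2 / ((P : ℝ) + 2) ≠ 0 := by positivity
  have h1 : (ballSecondMoment P r)⁻¹ =
      (r ^ 2 / ((P : ℝ) + 2))⁻¹ • (1 : Matrix (Fin P) (Fin P) ℝ) := by
    refine Matrix.inv_eq_right_inv ?_
    rw [ballSecondMoment_eq P hr, smul_mul_smul_comm, mul_inv_cancel₀ h0, one_smul, one_mul]
  have h2 : ∀ w : EuclideanSpace ℝ (Fin P), (r • w) i * f (x + r • w) =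
      r * (⟪EuclideanSpace.single i (1 : ℝ), w⟫ * f (x + r • w)) := fun w => by
    simp only [EuclideanSpace.inner_single_left, PiLp.smul_apply, smul_eq_mul, map_one, one_mul]
    ring
  rw [localRegressionCoeff, h1, Matrix.smul_mulVec, Matrix.one_mulVec, Pi.smul_apply,
    setAverage_ball_comp_smul _ hr, ballMoment, setAverage_eq, setAverage_eq]
  simp_rw [h2]
  rw [integral_const_mul]
  simp only [smul_eq_mul]
  field_simp

theorem normalOuterProduct_apply (h : EuclideanSpace ℝ (Fin P) → ℝ) (x : EuclideanSpace ℝ (Fin P))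
    (i k : Fin P) : normalOuterProduct h x i k =
      ⟪EuclideanSpace.single i 1, ∇ h x⟫ * ⟪EuclideanSpace.single k 1, ∇ h x⟫ / ‖∇ h x‖ ^ 2 := by
  simp only [normalOuterProduct, Matrix.smul_apply, Matrix.vecMulVec_apply, smul_eq_mul,
    EuclideanSpace.inner_single_left, map_one, one_mul]
  ring

theorem jumpFunction_eq_sum {J : ℕ} (c : Fin J → ℝ) (h : Fin J → EuclideanSpace ℝ (Fin P) → ℝ)
    (g : EuclideanSpace ℝ (Fin P) → ℝ) :
    jumpFunction c h g = fun x => ∑ o, jumpCoeff c o * jumpPiece h g o x := by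
  ext x
  rw [sum_jumpCoeff_mul_jumpPiece]
  rfl

end Euclidean

-- Bilinear expansion over the pieces of `f`; every ball about a point of `X` lies in `K`, where
-- each piece is bounded and measurable, so the moment is additive.
open scoped ENNReal NNReal RealInnerProductSpace in
theorem indicator_mul_localRegressionCoeff_mul {P J : ℕ}
    {X K : Set (EuclideanSpace ℝ (Fin P))} {δ : EuclideanSpace ℝ (Fin P) → ℝ}
    (c : Fin J → ℝ) {h : Fin J → EuclideanSpace ℝ (Fin P) → ℝ} {g : EuclideanSpace ℝ (Fin P) → ℝ}
    {C : ℝ} (hm : ∀ o, Measurable (K.indicator (jumpPiece h g o)))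
    (hC : ∀ o, ∀ x ∈ K, |jumpPiece h g o x| ≤ C) {r : ℝ} (hr : 0 < r)
    (hK : ∀ x ∈ X, Metric.ball x r ⊆ K) (i k : Fin P) :
    (X.indicator fun x => δ x * Matrix.vecMulVec (localRegressionCoeff (jumpFunction c h g) r x)
      (localRegressionCoeff (jumpFunction c h g) r x) i k) =
    fun x => (((P : ℝ) + 2) / r) ^ 2 * ∑ o, ∑ o', jumpCoeff c o * jumpCoeff c o' *
      momentProduct X δ (jumpPiece h g o) (jumpPiece h g o') (EuclideanSpace.single i 1)
        (EuclideanSpace.single k 1) r x := by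
  ext x
  by_cases hx : x ∈ X
  · have hs : ∀ u, ballMoment (jumpFunction c h g) u r x =
        ∑ o, jumpCoeff c o * ballMoment (jumpPiece h g o) u r x := fun u => by
      rw [jumpFunction_eq_sum]
      exact ballMoment_sum _ _ u fun o _ => integrableOn_ball_inner_mul (hm o) (hC o) u fun w hw =>
        hK x hx (add_smul_mem_ball hr x hw)
    simp only [Set.indicator_of_mem hx, momentProduct, Matrix.vecMulVec_apply,
      localRegressionCoeff_eq _ hr, hs]
    rw [mul_mul_mul_comm, ← sq, Finset.sum_mul_sum, mul_left_comm, Finset.mul_sum]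
    congr 1
    refine Finset.sum_congr rfl fun o _ => ?_
    rw [Finset.mul_sum]
    exact Finset.sum_congr rfl fun o' _ => by ring
  · simp [Set.indicator_of_notMem hx, momentProduct]

theorem theorem3 (P J : ℕ)
    -- the compact input space `X`, and an open neighbourhood `U` of it
    (X U : Set (EuclideanSpace ℝ (Fin P))) (hX : IsCompact X) (hU : IsOpen U) (hXU : X ⊆ U)
    -- the ingredients of `f = ∑ j, c j * 1[h j ≤ 0] + g`
    (c : Fin J → ℝ) (h : Fin J → EuclideanSpace ℝ (Fin P) → ℝ)
    (g : EuclideanSpace ℝ (Fin P) → ℝ)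
    (hh : ∀ j, ContDiffOn ℝ 1 (h j) U) (hg : ContDiffOn ℝ 1 g U)
    (hgrad : ∀ j, ∀ x ∈ X, h j x = 0 → ∇ (h j) x ≠ 0)
    -- the probability measure `μ` on `X`, with a continuous Lebesgue density `δ`
    (μ : Measure (EuclideanSpace ℝ (Fin P))) [IsProbabilityMeasure μ]
    (δ : EuclideanSpace ℝ (Fin P) → ℝ) (hδ : ContinuousOn δ X) (hδ0 : ∀ x ∈ X, 0 ≤ δ x)
    (hμ : μ = (volume.restrict X).withDensity (fun x => ENNReal.ofReal (δ x)))
    -- the jump sets overlap each other, and the boundary of `X`, in sets of zero surface measure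
    (hoverlap : ∀ j k, j ≠ k → μHE[P - 1] {x ∈ X | h j x = 0 ∧ h k x = 0 ∧ δ x ≠ 0} = 0)
    (hboundary : ∀ j, μHE[P - 1] {x ∈ frontier X | h j x = 0 ∧ δ x ≠ 0} = 0) :
    -- all the integrals involved exist
    (∀ᶠ r in 𝓝[>] (0 : ℝ),
      (∀ x ∈ X, IntegrableOn (jumpFunction c h g) (Metric.ball x r) volume) ∧
      ∀ i k, Integrable (fun x => Matrix.vecMulVec (localRegressionCoeff (jumpFunction c h g) r x)
        (localRegressionCoeff (jumpFunction c h g) r x) i k) μ) ∧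
    (∀ j i k, IntegrableOn (fun x => normalOuterProduct (h j) x i k * δ x)
      {x ∈ X | h j x = 0} μHE[P - 1]) ∧
    -- the limit
    Tendsto (fun r : ℝ => (jumpConst P * r) • regressionOuterProduct (jumpFunction c h g) μ r)
      (𝓝[>] 0)
      (𝓝 (∑ j, c j ^ 2 • Matrix.of fun i k =>
        ∫ x in {x ∈ X | h j x = 0}, normalOuterProduct (h j) x i k * δ x ∂μHE[P - 1])) := by
  classical
  have hfin : Module.finrank ℝ (EuclideanSpace ℝ (Fin P)) = P := by simp
  obtain ⟨K, hKU, hKc, -, hK⟩ := exists_isCompact_forall_add_mem hX hU hXU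
  have hm := measurable_indicator_jumpPiece hKc (fun j => (hh j).continuousOn.mono hKU)
    (hg.continuousOn.mono hKU)
  obtain ⟨C, hC0, hC⟩ := exists_abs_jumpPiece_le hKc h (hg.continuousOn.mono hKU)
  have hδm : AEMeasurable (fun x => ENNReal.ofReal (δ x)) (volume.restrict X) :=
    (hδ.aemeasurable hX.measurableSet).ennreal_ofReal
  have hδt : ∀ᵐ x ∂volume.restrict X, ENNReal.ofReal (δ x) < ⊤ :=
    Eventually.of_forall fun _ => ENNReal.ofReal_lt_top
  have hδX : ∀ G : EuclideanSpace ℝ (Fin P) → ℝ, ∀ x ∈ X,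
      (ENNReal.ofReal (δ x)).toReal • G x = δ x * G x := fun G x hx => by
    rw [ENNReal.toReal_ofReal (hδ0 x hx), smul_eq_mul]
  have hint : ∀ i k, ∀ᶠ r in 𝓝[>] (0 : ℝ), ∀ o o', Integrable (momentProduct X δ
      (jumpPiece h g o) (jumpPiece h g o') (EuclideanSpace.single i 1)
        (EuclideanSpace.single k 1) r) := fun i k =>
    eventually_all.2 fun o => eventually_all.2 fun o' =>
      eventually_integrable_momentProduct hX hδ hK hC0 hC0 (hm o) (hm o') (hC o) (hC o') _ _
  have hN : ∀ j i k, IntegrableOn (fun x => normalOuterProduct (h j) x i k * δ x)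
      {x ∈ X | h j x = 0} μHE[P - 1] := fun j i k => by
    have h1 := integrableOn_normal_mul_normal hX hU hXU (hh j) (hgrad j) hδ
      (EuclideanSpace.single i 1) (EuclideanSpace.single k 1)
    rw [hfin] at h1
    simpa only [normalOuterProduct_apply] using h1
  refine ⟨?_, hN, ?_⟩
  · filter_upwards [hK, eventually_all.2 fun i => eventually_all.2 fun k => hint i k,
      self_mem_nhdsWithin] with r hr hri (hr0 : 0 < r)
    refine ⟨fun x hx => ?_, fun i k => ?_⟩
    · rw [jumpFunction_eq_sum]
      refine integrable_finsetSum _ fun o _ => Integrable.const_mul ?_ _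
      have h1 : IntegrableOn (K.indicator (jumpPiece h g o)) (Metric.ball x r) := by
        refine Measure.integrableOn_of_bounded (M := C) measure_ball_lt_top.ne
          (hm o).aestronglyMeasurable (Eventually.of_forall fun y => ?_)
        exact abs_indicator_le_of_forall_mem hC0 (hC o) y
      exact h1.congr_fun (fun y hy => Set.indicator_of_mem (hr x hx hy) _) measurableSet_ball
    · rw [hμ, integrable_withDensity_iff_integrable_smul₀' hδm hδt]
      refine IntegrableOn.congr_fun ?_ (fun x hx => (hδX (fun x => Matrix.vecMulVec
        (localRegressionCoeff (jumpFunction c h g) r x)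
        (localRegressionCoeff (jumpFunction c h g) r x) i k) x hx).symm) hX.measurableSet
      rw [← integrable_indicator_iff hX.measurableSet,
        indicator_mul_localRegressionCoeff_mul c hm hC hr0 hr]
      exact (integrable_finsetSum _ fun o _ => integrable_finsetSum _ fun o' _ =>
        (hri i k o o').const_mul _).const_mul _
  · refine tendsto_pi_nhds.2 fun i => tendsto_pi_nhds.2 fun k => ?_
    -- A row index exists only in positive dimension; for `P = 0` there are no entries to check.
    have hP : 1 ≤ P := i.pos
    have hlim : Tendsto (fun r => jumpConst P * ((P : ℝ) + 2) ^ 2 * ∑ o, ∑ o',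
        jumpCoeff c o * jumpCoeff c o' * (r⁻¹ * ∫ x, momentProduct X δ (jumpPiece h g o)
          (jumpPiece h g o') (EuclideanSpace.single i 1) (EuclideanSpace.single k 1) r x))
        (𝓝[>] 0) (𝓝 (jumpConst P * ((P : ℝ) + 2) ^ 2 * ∑ o, ∑ o', jumpCoeff c o * jumpCoeff c o' *
          pieceLimit X δ h (EuclideanSpace.single i 1) (EuclideanSpace.single k 1) o o')) :=
      (tendsto_finsetSum _ fun o _ => tendsto_finsetSum _ fun o' _ =>
        (tendsto_integral_momentProduct_jumpPiece hX hU hXU hh hg hgrad hδ (by rwa [hfin])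
          (by rwa [hfin]) _ _ o o').const_mul _).const_mul _
    -- The constants `A_P`, `(P + 2)²` and the integral of the squared profile multiply to one.
    rw [sum_sum_mul_pieceLimit, hfin, ← mul_assoc, mul_assoc (jumpConst P),
      jumpConst_mul_eq_one hP, one_mul] at hlim
    have hR : (∑ j, c j ^ 2 • Matrix.of fun i k => ∫ x in {x ∈ X | h j x = 0},
        normalOuterProduct (h j) x i k * δ x ∂μHE[P - 1] : Matrix (Fin P) (Fin P) ℝ) i k =
        ∑ j, c j ^ 2 * ∫ y in {x ∈ X | h j x = 0},
          inner ℝ (EuclideanSpace.single i 1) (∇ (h j) y) *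
            inner ℝ (EuclideanSpace.single k 1) (∇ (h j) y) /
            ‖∇ (h j) y‖ ^ 2 * δ y ∂μHE[P - 1] := by
      simp only [Matrix.sum_apply, Matrix.smul_apply, Matrix.of_apply, smul_eq_mul,
        normalOuterProduct_apply]
    rw [hR]
    refine hlim.congr' ?_
    filter_upwards [hK, hint i k, self_mem_nhdsWithin] with r hr hri (hr0 : 0 < r)
    rw [Matrix.smul_apply, regressionOuterProduct, Matrix.of_apply, hμ,
      integral_withDensity_eq_integral_toReal_smul₀ hδm hδt,
      setIntegral_congr_fun hX.measurableSet (hδX _), ← integral_indicator hX.measurableSet,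
      indicator_mul_localRegressionCoeff_mul c hm hC hr0 hr, integral_const_mul,
      integral_finsetSum _ fun o _ => integrable_finsetSum _ fun o' _ =>
        (hri o o').const_mul _]
    simp_rw [integral_finsetSum _ fun o' _ => (hri _ o').const_mul _, integral_const_mul]
    simp only [smul_eq_mul, Finset.mul_sum]
    refine Finset.sum_congr rfl fun o _ => Finset.sum_congr rfl fun o' _ => ?_
    -- The powers of `r` agree: `r * ((P + 2) / r) ^ 2 = (P + 2) ^ 2 * r⁻¹`.
    field_simp
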